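/- For an integer $n\ge 4$ let $W_n = K_1\vee C_{n-1}$ be the wheel of order $n$, i.e. the graph on $n$ vertices obtained from the cycle $C_{n-1}$ on $n-1$ vertices by adding one new vertex adjacent to all vertices of the cycle. For graphs $G$ and $H$ let $R(G,H)$ be the minimum integer $N\ge 0$ such that every coloring of the edges of the complete graph $K_N$ with the colors red and blue contains a red copy of $G$ or a blue copy of $H$ (copies are subgraphs, not necessarily induced). Then for every integer $n\ge 7$, $$ \begin{cases} 3n-3\le R(W_n,W_n)\le 8n-10, & \text{if } n \text{ is even},\\ 2n-2\le R(W_n,W_n)\le 6n-8, & \text{if } n \text{ is odd}. \end{cases} $$ -/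

import Mathlib

/-- The join `G ∨ H`: the disjoint union of `G` and `H` together with all edges between them. -/
def SimpleGraph.joinGraph {V W : Type*} (G : SimpleGraph V) (H : SimpleGraph W) :
    SimpleGraph (V ⊕ W) :=
  (G ⊕g H) ⊔ completeBipartiteGraph V W

/-- The wheel `W_n = K_1 ∨ C_{n-1}` of order `n` (meaningful for `n ≥ 4`). -/
def wheelGraph (n : ℕ) : SimpleGraph (Fin 1 ⊕ Fin (n - 1)) :=
  SimpleGraph.joinGraph (⊤ : SimpleGraph (Fin 1)) (SimpleGraph.cycleGraph (n - 1))

/-- The two colors of an edge coloring. -/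
inductive RamseyColor
  | red
  | blue

/-- Every red-blue coloring of the edges of `K_N` contains a red copy of `G` or a blue copy of `H`
(copies are not necessarily induced subgraphs). -/
def RamseyProperty {V W : Type*} (G : SimpleGraph V) (H : SimpleGraph W) (N : ℕ) : Prop :=
  ∀ c : SimpleGraph.TopEdgeLabeling (Fin N) RamseyColor,
    G.IsContained (c.labelGraph RamseyColor.red) ∨ H.IsContained (c.labelGraph RamseyColor.blue)

/-- The Ramsey number `R(G, H)`: the minimum `N` such that every red-blue coloring of `K_N`
contains a red copy of `G` or a blue copy of `H`. A positive value is attained. -/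
noncomputable def ramseyNumber {V W : Type*} (G : SimpleGraph V) (H : SimpleGraph W) : ℕ :=
  sInf {N : ℕ | RamseyProperty G H N}

/-- A positive value of `ramseyNumber` is a genuine minimum, not the default value at `∅`. -/
theorem isLeast_ramseyNumber_of_pos {V W : Type*} {G : SimpleGraph V} {H : SimpleGraph W}
    (h : 0 < ramseyNumber G H) :
    IsLeast {N : ℕ | RamseyProperty G H N} (ramseyNumber G H) :=
  ⟨Nat.sInf_mem (Nat.nonempty_of_pos_sInf h), fun _ hN => Nat.sInf_le hN⟩

/-!
The wheel `W_n` consists of a hub and a rim of length `m = n - 1`. A red-blue coloring of a complete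
graph is treated as a graph `G` together with its complement.

*Upper bounds.* Let `c ≥ m` be such that every 2-coloring of a complete graph on `c` vertices has a
monochromatic cycle of length `m`. On `2 * c + 1` vertices, `G` has a cycle of length `m` or its
complement contains a wheel (`hasCycle_or_hasWheel_compl`): if some vertex has `c` non-neighbors,
then a monochromatic cycle among these is a cycle of `G` or the rim of a wheel in the complement;
otherwise all degrees of `G` exceed half the number of vertices, so `G` has cycles of all lengths
by Bondy's theorem (`hasCycle_of_degree`). On `4 * c + 2` vertices every vertex has `2 * c + 1`
incident edges of one color, and the previous statement, applied to their other ends, gives a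
monochromatic wheel. The two upper bounds are `4 * c + 2` for `c = 3 * k - 1` if `m = 2 * k` and
for `c = 4 * r - 3` if `m = 2 * r - 1`.

*Ramsey numbers of cycles.* That these values of `c` suffice is shown in `hasMonoCycle_even` and
`hasMonoCycle_odd`. The core is `exists_long_monoCycle`: on `3 * k - 1` vertices there is a
monochromatic cycle of length at least `2 * k`. The proof is by induction on `k`. A cycle of length
`2 * k - 2` or `2 * k - 1` in `G` is compared with the vertices outside: if each of these has many
non-neighbors on the cycle, then Jackson's theorem on bipartite graphs (`hasCycle_between`) gives
the longer cycle in the complement. Otherwise a vertex outside has every second vertex of the cycle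
as a neighbor, and this structure leads to the longer cycle by
`exists_long_monoCycle_of_configuration`. A long cycle is then shortened to the required length one
or two vertices at a time: if neither color contains the shorter cycle, then the chords of the cycle
have prescribed colors (`hasCycle_sub_one_of_odd`, `exists_cliques_of_hasCycle_even`).

*Lower bounds.* Disjoint red complete graphs on `n - 1` vertices, three if `m` is odd and two if `m`
is even, with blue edges between them, contain no monochromatic wheel: the red components have fewer
than `n` vertices, and the chromatic number of the wheel is one larger than that of the blue graph
(`lt_of_ramseyProperty_wheelGraph`).
-/

namespace SimpleGraph

variable {V : Type*} {G : SimpleGraph V}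

/-! ### Vertex sequences of paths and cycles -/

/-- The list `l` is the vertex sequence of a path of `G` from `a` to `b`. -/
def IsPathList (G : SimpleGraph V) (l : List V) (a b : V) : Prop :=
  l.IsChain G.Adj ∧ l.Nodup ∧ l.head? = some a ∧ l.getLast? = some b

/-- The function `f` runs around a cycle of length `L` in `G`. Indices are integers and `f` has
period `L`, so that rotations and reflections of a cycle are substitutions in the index. -/
def IsCycleFun (G : SimpleGraph V) (L : ℕ) (f : ℤ → V) : Prop :=
  (∀ i j, f i = f j ↔ (L : ℤ) ∣ i - j) ∧ ∀ i, G.Adj (f i) (f (i + 1))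

/-- `G` contains a cycle with exactly `L` vertices. -/
def HasCycle (G : SimpleGraph V) (L : ℕ) : Prop :=
  3 ≤ L ∧ ∃ f, G.IsCycleFun L f

namespace IsPathList

theorem singleton (a : V) : G.IsPathList [a] a a := by
  simp [IsPathList]

theorem pair {a b : V} (h : G.Adj a b) : G.IsPathList [a, b] a b := by
  simp [IsPathList, h, h.ne]

theorem append {l l' : List V} {a b c d : V} (h : G.IsPathList l a b) (h' : G.IsPathList l' c d)
    (hbc : G.Adj b c) (hd : ∀ x ∈ l, x ∉ l') : G.IsPathList (l ++ l') a d := by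
  obtain ⟨h1, h2, h3, h4⟩ := h
  obtain ⟨h1', h2', h3', h4'⟩ := h'
  refine ⟨?_, ?_, ?_, ?_⟩
  · rw [List.isChain_append]
    refine ⟨h1, h1', ?_⟩
    intro x hx y hy
    simp_all
  · rw [List.nodup_append]
    exact ⟨h2, h2', fun x hx y hy hxy => hd x hx (hxy ▸ hy)⟩
  · simp [List.head?_append, h3]
  · simp [List.getLast?_append, h4']

theorem reverse {l : List V} {a b : V} (h : G.IsPathList l a b) : G.IsPathList l.reverse b a := by
  obtain ⟨h1, h2, h3, h4⟩ := h
  refine ⟨?_, by simpa using h2, by simpa using h4, by simpa using h3⟩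
  rw [List.isChain_reverse]
  simpa [G.adj_comm] using h1

theorem cons {l : List V} {a b c : V} (h : G.IsPathList l b c) (hab : G.Adj a b) (ha : a ∉ l) :
    G.IsPathList (a :: l) a c :=
  (singleton a).append h hab (by simpa using ha)

theorem concat {l : List V} {a b c : V} (h : G.IsPathList l a b) (hbc : G.Adj b c) (hc : c ∉ l) :
    G.IsPathList (l ++ [c]) a c :=
  h.append (singleton c) hbc (by intro x hx; simp; rintro rfl; exact hc hx)

theorem head_mem {l : List V} {a b : V} (h : G.IsPathList l a b) : a ∈ l :=
  List.mem_of_mem_head? (by simp [h.2.2.1])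

/-- A path whose ends are adjacent closes up to a cycle. -/
theorem isCycleFun {l : List V} {a b : V} (h : G.IsPathList l a b) (hba : G.Adj b a) :
    ∃ f, G.IsCycleFun l.length f ∧ ∀ i, f i ∈ l := by
  obtain ⟨h1, h2, h3, h4⟩ := h
  have hpos : 0 < l.length := by cases l <;> simp_all
  have hposZ : (0 : ℤ) < l.length := by exact_mod_cast hpos
  have hlt (i : ℤ) : (i % l.length).toNat < l.length := by
    have := Int.emod_lt_of_pos i hposZ
    omega
  have hnn (i : ℤ) : 0 ≤ i % l.length := Int.emod_nonneg _ hposZ.ne'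
  refine ⟨fun i => l[(i % l.length).toNat]'(hlt i), ⟨?_, ?_⟩, fun i => List.getElem_mem _⟩
  · intro i j
    rw [h2.getElem_inj_iff, ← Int.emod_emod_of_dvd, ← Int.emod_emod_of_dvd,
      ← Int.emod_eq_emod_iff_emod_sub_eq_zero.trans Int.dvd_iff_emod_eq_zero.symm] <;> try rfl
    have := hnn i
    have := hnn j
    constructor
    · intro h; simp at h ⊢; omega
    · intro h; simp at h ⊢; omega
  · intro i
    show G.Adj (l[(i % l.length).toNat]'(hlt i)) (l[((i + 1) % l.length).toNat]'(hlt _))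
    have key : (i + 1) % (l.length : ℤ) =
        if i % l.length + 1 = l.length then 0 else i % l.length + 1 := by
      rw [Int.add_emod_eq_add_emod_right (n := l.length) (k := i % l.length) 1 (by simp)]
      split_ifs with hh
      · rw [hh]; simp
      · exact Int.emod_eq_of_lt (by have := hnn i; omega)
          (by have := Int.emod_lt_of_pos i hposZ; omega)
    by_cases hh : i % l.length + 1 = l.length
    · rw [if_pos hh] at key
      have e1 : (i % l.length).toNat = l.length - 1 := by omega
      have e2 : ((i + 1) % l.length).toNat = 0 := by omega
      simp only [e1, e2]
      rw [List.getLast?_eq_getElem?, List.getElem?_eq_some_iff] at h4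
      rw [List.head?_eq_getElem?, List.getElem?_eq_some_iff] at h3
      obtain ⟨_, h3⟩ := h3
      obtain ⟨_, h4⟩ := h4
      rw [h3, h4]
      exact hba
    · rw [if_neg hh] at key
      have e2 : ((i + 1) % l.length).toNat = (i % l.length).toNat + 1 := by
        have := hnn i; omega
      simp only [e2]
      exact h1.getElem _ _

theorem hasCycle {l : List V} {a b : V} (h : G.IsPathList l a b) (hba : G.Adj b a)
    (hl : 3 ≤ l.length) : G.HasCycle l.length :=
  ⟨hl, (h.isCycleFun hba).imp fun _ h => h.1⟩

end IsPathList

/-- The vertices `f a, f (a + 1), …, f (a + n - 1)`. -/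
def ascend (f : ℤ → V) (a : ℤ) (n : ℕ) : List V :=
  (List.range n).map fun i : ℕ => f (a + i)

/-- The vertices `f a, f (a - 1), …, f (a - n + 1)`. -/
def descend (f : ℤ → V) (a : ℤ) (n : ℕ) : List V :=
  (List.range n).map fun i : ℕ => f (a - i)

@[simp] theorem length_ascend (f : ℤ → V) (a : ℤ) (n : ℕ) : (ascend f a n).length = n := by
  simp [ascend]

@[simp] theorem length_descend (f : ℤ → V) (a : ℤ) (n : ℕ) : (descend f a n).length = n := by
  simp [descend]

theorem mem_ascend {f : ℤ → V} {a : ℤ} {n : ℕ} {x : V} :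
    x ∈ ascend f a n ↔ ∃ i : ℤ, a ≤ i ∧ i < a + n ∧ f i = x := by
  simp only [ascend, List.mem_map, List.mem_range]
  constructor
  · rintro ⟨i, hi, rfl⟩
    exact ⟨a + i, by omega, by omega, rfl⟩
  · rintro ⟨i, hi, hi', rfl⟩
    exact ⟨(i - a).toNat, by omega, by congr 1; omega⟩

theorem mem_descend {f : ℤ → V} {a : ℤ} {n : ℕ} {x : V} :
    x ∈ descend f a n ↔ ∃ i : ℤ, a - n < i ∧ i ≤ a ∧ f i = x := by
  simp only [descend, List.mem_map, List.mem_range]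
  constructor
  · rintro ⟨i, hi, rfl⟩
    exact ⟨a - i, by omega, by omega, rfl⟩
  · rintro ⟨i, hi, hi', rfl⟩
    exact ⟨(a - i).toNat, by omega, by congr 1; omega⟩

namespace IsCycleFun

variable {L : ℕ} {f : ℤ → V}

theorem adj (hf : G.IsCycleFun L f) {i j : ℤ} (h : j = i + 1) : G.Adj (f i) (f j) := by
  subst h; exact hf.2 i

theorem adj' (hf : G.IsCycleFun L f) {i j : ℤ} (h : i = j + 1) : G.Adj (f i) (f j) :=
  (hf.adj h).symm

theorem eq_of_dvd (hf : G.IsCycleFun L f) {i j : ℤ} (h : (L : ℤ) ∣ i - j) : f i = f j :=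
  (hf.1 i j).2 h

theorem add_period (hf : G.IsCycleFun L f) (i : ℤ) : f (i + L) = f i :=
  hf.eq_of_dvd (by simp)

theorem sub_period (hf : G.IsCycleFun L f) (i : ℤ) : f (i - L) = f i :=
  hf.eq_of_dvd (by simp)

/-- Indices less than a period apart carry different vertices. -/
theorem inj (hf : G.IsCycleFun L f) {i j : ℤ} (h : f i = f j) (h1 : i - j < L) (h2 : j - i < L) :
    i = j := by
  have := (hf.1 i j).1 h
  have := Int.eq_zero_of_abs_lt_dvd this (by rw [abs_lt]; omega)
  omega

theorem ne (hf : G.IsCycleFun L f) {i j : ℤ} (h : i ≠ j) (h1 : i - j < L) (h2 : j - i < L) :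
    f i ≠ f j :=
  fun h' => h (hf.inj h' h1 h2)

theorem shift (hf : G.IsCycleFun L f) (c : ℤ) : G.IsCycleFun L fun i => f (i + c) := by
  refine ⟨fun i j => ?_, fun i => hf.adj (by ring)⟩
  rw [hf.1]; simp

theorem reflect (hf : G.IsCycleFun L f) (c : ℤ) : G.IsCycleFun L fun i => f (c - i) := by
  refine ⟨fun i j => ?_, fun i => hf.adj' (by ring)⟩
  rw [hf.1, ← dvd_neg]; simp

theorem mono {H : SimpleGraph V} (hf : G.IsCycleFun L f) (h : G ≤ H) : H.IsCycleFun L f :=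
  ⟨hf.1, fun i => h (hf.2 i)⟩

theorem isPathList_ascend (hf : G.IsCycleFun L f) {a b : ℤ} {n : ℕ} (hn : 1 ≤ n) (hnL : n ≤ L)
    (hb : b = a + n - 1) : G.IsPathList (ascend f a n) (f a) (f b) := by
  refine ⟨?_, ?_, ?_, ?_⟩
  · rw [ascend, List.isChain_map, List.isChain_range]
    intro m hm
    exact hf.adj (by push_cast; ring)
  · refine (List.nodup_map_iff_inj_on List.nodup_range).2 ?_
    intro x hx y hy hxy
    rw [List.mem_range] at hx hy
    have := hf.inj hxy (by omega) (by omega)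
    omega
  · simp [ascend, List.head?_range, show n ≠ 0 by omega]
  · simp only [ascend, List.getLast?_map, List.getLast?_range, show n ≠ 0 by omega, if_false,
      Option.map_some]
    congr 2; omega

theorem isPathList_descend (hf : G.IsCycleFun L f) {a b : ℤ} {n : ℕ} (hn : 1 ≤ n) (hnL : n ≤ L)
    (hb : b = a - n + 1) : G.IsPathList (descend f a n) (f a) (f b) := by
  have := (hf.reflect 0).isPathList_ascend (a := -a) (b := -b) hn hnL (by omega)
  simp only [zero_sub, neg_neg] at this
  convert this using 2
  simp only [descend, ascend]
  congr 1; funext i; congr 1; ring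

/-- Replacing the `d - 1` vertices strictly between `f a` and `f (a + d)` by a path outside the
cycle. -/
theorem hasCycle_bridge (hf : G.IsCycleFun L f) {a b : ℤ} {d : ℕ} (hb : b = a + d) (hd : 1 ≤ d)
    (hdL : d < L) {l : List V} {s t : V} (hl : G.IsPathList l s t) (hfl : ∀ i, f i ∉ l)
    (hs : G.Adj (f a) s) (ht : G.Adj t (f b)) {n : ℕ} (hn : n + d = L + 1 + l.length)
    (hn3 : 3 ≤ n) : G.HasCycle n := by
  have h1 := hf.isPathList_ascend (a := b) (b := a + L) (n := L + 1 - d) (by omega) (by omega)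
    (by omega)
  have h2 := h1.append hl (by rwa [hf.add_period]) (by
    intro x hx
    obtain ⟨i, -, -, rfl⟩ := mem_ascend.1 hx
    exact hfl i)
  have := h2.hasCycle ht (by simp; omega)
  convert this using 1
  simp; omega

/-- If `u` is outside the cycle and adjacent to `f s` and `f t`, then a path runs through `u` and
the whole cycle from the successor of `f t` to the successor of `f s`. -/
theorem exists_isPathList_cross (hf : G.IsCycleFun L f) {s t : ℤ} (hst : s < t) (htL : t < s + L)
    {u : V} (hu : ∀ i, f i ≠ u) (hus : G.Adj u (f s)) (hut : G.Adj u (f t)) :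
    ∃ l, G.IsPathList l (f (t + 1)) (f (s + 1)) ∧ l.length = L + 1 ∧
      ∀ x ∈ l, x = u ∨ ∃ i, f i = x := by
  have h1 := hf.isPathList_ascend (a := t + 1) (b := s + L) (n := (s + L - t).toNat)
    (by omega) (by omega) (by omega)
  have h2 := hf.isPathList_descend (a := t) (b := s + 1) (n := (t - s).toNat)
    (by omega) (by omega) (by omega)
  have h3 := (h1.append (IsPathList.singleton u) (by rw [hf.add_period]; exact hus.symm) (by
    intro x hx
    obtain ⟨i, -, -, rfl⟩ := mem_ascend.1 hx
    simpa using hu i)).append h2 hut (by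
    intro x hx hx'
    obtain ⟨j, hj1, hj2, rfl⟩ := mem_descend.1 hx'
    rw [List.mem_append, mem_ascend] at hx
    rcases hx with ⟨i, hi1, hi2, hi3⟩ | hx
    · have := hf.inj hi3 (by omega) (by omega)
      omega
    · exact hu j (by simpa using hx))
  refine ⟨_, h3, by simp; omega, fun x hx => ?_⟩
  simp only [List.mem_append, mem_ascend, mem_descend, List.mem_singleton] at hx
  rcases hx with (⟨i, -, -, h⟩ | h) | ⟨i, -, -, h⟩
  · exact .inr ⟨i, h⟩
  · exact .inl h
  · exact .inr ⟨i, h⟩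

/-- If `u` is outside the cycle and adjacent to `f s` and `f t`, and the successors of `f s` and
`f t` have another common neighbor `b` outside the cycle, then some cycle runs through `u`, `b` and
the whole cycle. -/
theorem hasCycle_cross (hf : G.IsCycleFun L f) {s t : ℤ} (hst : s < t) (htL : t < s + L) {u b : V}
    (hu : ∀ i, f i ≠ u) (hus : G.Adj u (f s)) (hut : G.Adj u (f t)) (hfb : ∀ i, f i ≠ b)
    (hbu : b ≠ u) (hbs : G.Adj b (f (s + 1))) (hbt : G.Adj b (f (t + 1))) :
    G.HasCycle (L + 2) := by
  obtain ⟨l, hl, hlen, hmem⟩ := hf.exists_isPathList_cross hst htL hu hus hut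
  have := (hl.concat hbs.symm (c := b) (by
    intro hb
    rcases hmem b hb with h | ⟨i, h⟩
    · exact hbu h
    · exact hfb i h)).hasCycle hbt (by simp; omega)
  convert this using 1
  simp [hlen]

/-- If `u` is outside the cycle and adjacent to `f s` and `f t`, then a chord between the
successors of `f s` and `f t` closes a cycle through `u` and the whole cycle. -/
theorem hasCycle_cross_chord (hf : G.IsCycleFun L f) {s t : ℤ} (hst : s < t)
    (htL : t < s + L) {u : V} (hu : ∀ i, f i ≠ u) (hus : G.Adj u (f s)) (hut : G.Adj u (f t))
    (hc : G.Adj (f (s + 1)) (f (t + 1))) : G.HasCycle (L + 1) := by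
  obtain ⟨l, hl, hlen, -⟩ := hf.exists_isPathList_cross hst htL hu hus hut
  exact hlen ▸ hl.hasCycle hc (by omega)

end IsCycleFun

theorem HasCycle.mono {H : SimpleGraph V} {L : ℕ} (h : G.HasCycle L) (hGH : G ≤ H) :
    H.HasCycle L :=
  ⟨h.1, h.2.imp fun _ hf => hf.mono hGH⟩

/-! ### Paths and cycles in complete bipartite and complete subgraphs -/

section Bipartite

variable [DecidableEq V] {A B : Finset V}

theorem exists_isPathList_bipartite {n : ℕ} (hn : 1 ≤ n) :
    ∀ {A B : Finset V}, Disjoint A B → (∀ x ∈ A, ∀ y ∈ B, G.Adj x y) → n ≤ A.card → n ≤ B.card →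
      ∀ {a b : V}, a ∈ A → b ∈ B →
        ∃ l, G.IsPathList l a b ∧ l.length = 2 * n ∧ ∀ x ∈ l, x ∈ A ∪ B := by
  induction n, hn using Nat.le_induction with
  | base =>
    intro A B _ hadj _ _ a b ha hb
    exact ⟨[a, b], .pair (hadj a ha b hb), rfl, by simp [ha, hb]⟩
  | succ n hn ih =>
    intro A B hd hadj hA hB a b ha hb
    obtain ⟨y, hy⟩ : (B.erase b).Nonempty := by
      rw [← Finset.card_pos, Finset.card_erase_of_mem hb]; omega
    obtain ⟨x, hx⟩ : (A.erase a).Nonempty := by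
      rw [← Finset.card_pos, Finset.card_erase_of_mem ha]; omega
    rw [Finset.mem_erase] at hx hy
    obtain ⟨l, hl, hlen, hmem⟩ := ih (A := A.erase a) (B := B.erase y) (a := x) (b := b)
      (hd.mono (Finset.erase_subset _ _) (Finset.erase_subset _ _))
      (fun x hx y hy => hadj x (Finset.mem_of_mem_erase hx) y (Finset.mem_of_mem_erase hy))
      (by rw [Finset.card_erase_of_mem ha]; omega)
      (by rw [Finset.card_erase_of_mem hy.2]; omega)
      (by simp [hx]) (by simp [hb, hy.1.symm])
    have hyA : y ∉ A := fun h => Finset.disjoint_left.1 hd h hy.2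
    have haB : a ∉ B := fun h => Finset.disjoint_left.1 hd ha h
    refine ⟨a :: y :: l, (hl.cons (hadj x hx.2 y hy.2).symm ?_).cons (hadj a ha y hy.2) ?_,
      by simp [hlen]; ring, ?_⟩
    · intro h
      have := hmem y h
      simp [hyA] at this
    · have : a ≠ y := by rintro rfl; exact haB hy.2
      intro h
      rw [List.mem_cons] at h
      rcases h with h | h
      · exact this h
      · have := hmem a h
        simp [haB] at this
    · intro z hz
      simp only [List.mem_cons] at hz
      rcases hz with rfl | rfl | hz
      · simp [ha]
      · simp [hy.2]
      · have := hmem z hz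
        simp only [Finset.mem_union, Finset.mem_erase] at this ⊢
        tauto

theorem exists_isPathList_bipartite_same {n : ℕ} (hn : 1 ≤ n) (hd : Disjoint A B)
    (hadj : ∀ x ∈ A, ∀ y ∈ B, G.Adj x y) (hA : n + 1 ≤ A.card) (hB : n ≤ B.card) {a a' : V}
    (ha : a ∈ A) (ha' : a' ∈ A) (hne : a ≠ a') :
    ∃ l, G.IsPathList l a a' ∧ l.length = 2 * n + 1 ∧ ∀ x ∈ l, x ∈ A ∪ B := by
  obtain ⟨y, hy⟩ : B.Nonempty := by rw [← Finset.card_pos]; omega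
  obtain ⟨l, hl, hlen, hmem⟩ := exists_isPathList_bipartite (G := G) hn
    (A := B) (B := A.erase a) (hd.symm.mono_right (Finset.erase_subset _ _))
    (fun y hy x hx => (hadj x (Finset.mem_of_mem_erase hx) y hy).symm) hB
    (by rw [Finset.card_erase_of_mem ha]; omega) hy (b := a') (by simp [ha', hne.symm])
  refine ⟨a :: l, hl.cons (hadj a ha y hy) ?_, by simp [hlen], ?_⟩
  · intro h
    have := hmem a h
    simp only [Finset.mem_union, Finset.mem_erase, ne_eq, not_true_eq_false, false_and,
      or_false] at this
    exact Finset.disjoint_left.1 hd ha this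
  · intro z hz
    rw [List.mem_cons] at hz
    rcases hz with rfl | hz
    · simp [ha]
    · have := hmem z hz
      simp only [Finset.mem_union, Finset.mem_erase] at this ⊢
      tauto

theorem hasCycle_bipartite {n : ℕ} (hn : 2 ≤ n) (hd : Disjoint A B)
    (hadj : ∀ x ∈ A, ∀ y ∈ B, G.Adj x y) (hA : n ≤ A.card) (hB : n ≤ B.card) :
    G.HasCycle (2 * n) := by
  obtain ⟨a, ha⟩ : A.Nonempty := by rw [← Finset.card_pos]; omega
  obtain ⟨b, hb⟩ : B.Nonempty := by rw [← Finset.card_pos]; omega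
  obtain ⟨l, hl, hlen, -⟩ := exists_isPathList_bipartite (by omega : 1 ≤ n) hd hadj hA hB ha hb
  exact hlen ▸ hl.hasCycle (hadj a ha b hb).symm (by omega)

/-- In a complete bipartite graph with at least `s` vertices on both sides, any two vertices are
the ends of a path with at least `2 * s - 1` vertices. -/
theorem exists_long_isPathList_bipartite {s : ℕ} (hs : 1 ≤ s) (hd : Disjoint A B)
    (hadj : ∀ x ∈ A, ∀ y ∈ B, G.Adj x y) (hA : s ≤ A.card) (hB : s ≤ B.card) {a b : V}
    (ha : a ∈ A ∪ B) (hb : b ∈ A ∪ B) (hne : a ≠ b) :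
    ∃ l, G.IsPathList l a b ∧ 2 * s - 1 ≤ l.length ∧ ∀ x ∈ l, x ∈ A ∪ B := by
  have hadj' : ∀ y ∈ B, ∀ x ∈ A, G.Adj y x := fun y hy x hx => (hadj x hx y hy).symm
  have two : ∀ {S : Finset V}, a ∈ S → b ∈ S → 2 ≤ S.card := fun h1 h2 =>
    Finset.one_lt_card.2 ⟨a, h1, b, h2, hne⟩
  rw [Finset.mem_union] at ha hb
  rcases ha with ha | ha <;> rcases hb with hb | hb
  · have := two ha hb
    obtain ⟨l, hl, hlen, hmem⟩ := exists_isPathList_bipartite_same (n := max (s - 1) 1)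
      (by omega) hd hadj (by omega) (by omega) ha hb hne
    exact ⟨l, hl, by omega, hmem⟩
  · obtain ⟨l, hl, hlen, hmem⟩ := exists_isPathList_bipartite hs hd hadj hA hB ha hb
    exact ⟨l, hl, by omega, hmem⟩
  · obtain ⟨l, hl, hlen, hmem⟩ := exists_isPathList_bipartite hs hd.symm hadj' hB hA ha hb
    exact ⟨l, hl, by omega, fun x hx => Finset.union_comm A B ▸ hmem x hx⟩
  · have := two ha hb
    obtain ⟨l, hl, hlen, hmem⟩ := exists_isPathList_bipartite_same (n := max (s - 1) 1)
      (by omega) hd.symm hadj' (by omega) (by omega) ha hb hne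
    exact ⟨l, hl, by omega, fun x hx => Finset.union_comm A B ▸ hmem x hx⟩

theorem exists_isPathList_clique {n : ℕ} (hn : 2 ≤ n) :
    ∀ {A : Finset V}, (∀ x ∈ A, ∀ y ∈ A, x ≠ y → G.Adj x y) → n ≤ A.card →
      ∀ {a b : V}, a ∈ A → b ∈ A → a ≠ b →
        ∃ l, G.IsPathList l a b ∧ l.length = n ∧ ∀ x ∈ l, x ∈ A := by
  induction n, hn using Nat.le_induction with
  | base =>
    intro A hadj _ a b ha hb hab
    exact ⟨[a, b], .pair (hadj a ha b hb hab), rfl, by simp [ha, hb]⟩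
  | succ n hn ih =>
    intro A hadj hA a b ha hb hab
    obtain ⟨c, hc⟩ : ((A.erase a).erase b).Nonempty := by
      rw [← Finset.card_pos, Finset.card_erase_of_mem (by simp [hb, hab.symm]),
        Finset.card_erase_of_mem ha]
      omega
    simp only [Finset.mem_erase] at hc
    obtain ⟨l, hl, hlen, hmem⟩ := ih (A := A.erase a) (a := c) (b := b)
      (fun x hx y hy => hadj x (Finset.mem_of_mem_erase hx) y (Finset.mem_of_mem_erase hy))
      (by rw [Finset.card_erase_of_mem ha]; omega)
      (by simp [hc]) (by simp [hb, hab.symm]) hc.1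
    refine ⟨a :: l, hl.cons (hadj a ha c hc.2.2 (Ne.symm hc.2.1)) ?_, by simp [hlen], ?_⟩
    · intro h
      simpa using hmem a h
    · intro z hz
      rw [List.mem_cons] at hz
      rcases hz with rfl | hz
      · exact ha
      · exact Finset.mem_of_mem_erase (hmem z hz)

end Bipartite

/-- If a relation between `X` and `Y` has no two disjoint pairs, then its pairs have a common
member. -/
theorem star_of_no_two_disjoint {X Y : Finset V} {R : V → V → Prop} (hX : X.Nonempty)
    (h : ∀ x ∈ X, ∀ x' ∈ X, ∀ y ∈ Y, ∀ y' ∈ Y, x ≠ x' → y ≠ y' → R x y → R x' y' → False) :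
    (∃ c ∈ X, ∀ x ∈ X, x ≠ c → ∀ y ∈ Y, ¬R x y) ∨ ∃ c ∈ Y, ∀ y ∈ Y, y ≠ c → ∀ x ∈ X, ¬R x y := by
  by_cases h0 : ∃ x ∈ X, ∃ y ∈ Y, R x y
  · obtain ⟨x, hx, y, hy, hxy⟩ := h0
    by_cases h1 : ∀ x' ∈ X, x' ≠ x → ∀ y' ∈ Y, ¬R x' y'
    · exact .inl ⟨x, hx, h1⟩
    · push Not at h1
      obtain ⟨x', hx', hne, y', hy', hxy'⟩ := h1
      have hyy : y' = y := by
        by_contra hh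
        exact h x' hx' x hx y' hy' y hy hne hh hxy' hxy
      subst hyy
      refine .inr ⟨y', hy', fun z hz hzy w hw hwz => ?_⟩
      by_cases hwx : w = x
      · subst hwx
        exact h w hw x' hx' z hz y' hy' hne.symm hzy hwz hxy'
      · exact h w hw x hx z hz y' hy' hwx hzy hwz hxy
  · push Not at h0
    obtain ⟨x, hx⟩ := hX
    exact .inl ⟨x, hx, fun x' hx' _ y hy => h0 x' hx' y hy⟩

/-! ### Shortening a monochromatic cycle by one -/

namespace IsCycleFun

variable {L : ℕ} {f : ℤ → V}

theorem compl_adj (hf : G.IsCycleFun L f) {i j : ℤ} (hij : i ≠ j) (h1 : i - j < L)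
    (h2 : j - i < L) (h : ¬G.Adj (f i) (f j)) : Gᶜ.Adj (f i) (f j) := by
  rw [SimpleGraph.compl_adj]
  exact ⟨hf.ne hij h1 h2, h⟩

theorem compl_adj_two (hf : G.IsCycleFun L f) (hL : 4 ≤ L) (hG : ¬G.HasCycle (L - 1)) {i j : ℤ}
    (hij : j = i + 2) : Gᶜ.Adj (f i) (f j) := by
  refine hf.compl_adj (by omega) (by omega) (by omega) fun h => hG ?_
  have h1 := hf.isPathList_ascend (a := j) (b := i + L) (n := L - 1) (by omega) (by omega)
    (by omega)
  rw [hf.add_period] at h1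
  simpa using h1.hasCycle h (by simp; omega)

/-- On a cycle of odd length, the chords of length 2 form another cycle through all vertices. -/
theorem two_mul (hf : G.IsCycleFun L f) (hL : 4 ≤ L) (hodd : Odd L) (hG : ¬G.HasCycle (L - 1)) :
    Gᶜ.IsCycleFun L fun i => f (2 * i) := by
  refine ⟨fun i j => ?_, fun i => hf.compl_adj_two hL hG (by ring)⟩
  rw [hf.1, ← mul_sub]
  have hco : IsCoprime (L : ℤ) 2 := by
    exact_mod_cast Nat.isCoprime_iff_coprime.2 (Nat.coprime_two_right.2 hodd)
  exact ⟨hco.dvd_of_dvd_mul_left, fun h => h.mul_left _⟩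

/-- A chord of length 4 is a chord of length 2 of the cycle in `two_mul`. -/
theorem adj_four (hf : G.IsCycleFun L f) (hL : 4 ≤ L) (hodd : Odd L) (hG : ¬G.HasCycle (L - 1))
    (hG' : ¬Gᶜ.HasCycle (L - 1)) {i j : ℤ} (hij : j = i + 4) : G.Adj (f i) (f j) := by
  have := ((hf.shift i).two_mul hL hodd hG).compl_adj_two hL hG' (i := 0) (j := 2) rfl
  rw [compl_compl] at this
  convert this using 2 <;> omega

theorem compl_adj_three (hf : G.IsCycleFun L f) (hL : 7 ≤ L) (hodd : Odd L)
    (hG : ¬G.HasCycle (L - 1)) (hG' : ¬Gᶜ.HasCycle (L - 1)) {i j : ℤ} (hij : j = i + 3) :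
    Gᶜ.Adj (f i) (f j) := by
  refine hf.compl_adj (by omega) (by omega) (by omega) fun h => hG ?_
  -- The cycle `f (i - 2), f (i + 2), f (i + 1), f i, f (i + 3), f (i + 4), …` misses `f (i - 1)`.
  have h1 := hf.isPathList_ascend (a := j) (b := i - 2 + L) (n := L - 4) (by omega) (by omega)
    (by omega)
  have h2 := hf.isPathList_descend (a := i + 2) (b := i) (n := 3) (by omega) (by omega)
    (by omega)
  have h3 := h1.append h2 (by
      rw [hf.add_period]
      exact hf.adj_four (by omega) hodd hG hG' (by ring)) (by
    intro x hx hx'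
    obtain ⟨a, ha1, ha2, rfl⟩ := mem_ascend.1 hx
    obtain ⟨b, hb1, hb2, hb3⟩ := mem_descend.1 hx'
    have := hf.inj hb3 (by omega) (by omega)
    omega)
  have := h3.hasCycle h (by simp)
  convert this using 1
  simp; omega

end IsCycleFun

/-- A monochromatic cycle of odd length `L ≥ 7` forces one of length `L - 1`. Otherwise chords of
length 2 and 3 have the other color than the cycle; the chords of length 2 form a cycle through the
same vertices, so chords of length 4 and 6 have the color of the cycle, and they shorten it. -/
theorem hasCycle_sub_one_of_odd {L : ℕ} (hL : 7 ≤ L) (hodd : Odd L) (h : G.HasCycle L) :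
    G.HasCycle (L - 1) ∨ Gᶜ.HasCycle (L - 1) := by
  by_contra! hno
  obtain ⟨hG, hG'⟩ := hno
  obtain ⟨-, f, hf⟩ := h
  have six : G.Adj (f 0) (f 6) := by
    have := (hf.two_mul (by omega) hodd hG).compl_adj_three hL hodd hG' (by rwa [compl_compl])
      (i := 0) (j := 3) rfl
    rwa [compl_compl] at this
  have four : ∀ {i j : ℤ}, j = i + 4 → G.Adj (f i) (f j) :=
    fun h => hf.adj_four (by omega) hodd hG hG' h
  by_cases hL7 : L = 7
  · have h1 : G.Adj (f 3) (f (0 + L)) := four (by omega)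
    rw [hf.add_period] at h1
    have h2 := hf.compl_adj_three hL hodd hG hG' (i := 0) (j := 3) rfl
    exact ((SimpleGraph.compl_adj _ _ _).1 h2).2 h1.symm
  · obtain ⟨r, hr⟩ := hodd
    -- The cycle `f 0, f 6, f 5, f 1, f 2, f 3, f 7, f 8, …` misses `f 4`.
    have h1 := hf.isPathList_ascend (a := 7) (b := 0 + L) (n := L - 6) (by omega) (by omega)
      (by omega)
    have h2 := hf.isPathList_descend (a := 6) (b := 5) (n := 2) (by omega) (by omega) (by omega)
    have h3 := hf.isPathList_ascend (a := 1) (b := 3) (n := 3) (by omega) (by omega) (by omega)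
    rw [hf.add_period] at h1
    have h4 := (h1.append h2 six (by
      intro x hx hx'
      obtain ⟨a, ha1, ha2, rfl⟩ := mem_ascend.1 hx
      obtain ⟨b, hb1, hb2, hb3⟩ := mem_descend.1 hx'
      have := hf.inj hb3 (by omega) (by omega)
      omega)).append h3 (four (i := 1) rfl).symm (by
      intro x hx hx'
      obtain ⟨b, hb1, hb2, rfl⟩ := mem_ascend.1 hx'
      simp only [List.mem_append, mem_ascend, mem_descend] at hx
      rcases hx with ⟨a, ha1, ha2, ha3⟩ | ⟨a, ha1, ha2, ha3⟩ <;>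
      · have := hf.inj ha3 (by omega) (by omega)
        omega)
    refine hG ?_
    have := h4.hasCycle (four (i := 3) rfl) (by simp)
    convert this using 1
    simp; omega

namespace IsCycleFun

variable {L r : ℕ} {f : ℤ → V}

/-- The cycle `f a, f b, f (b - 1), …, f (a + 1), f (b + 2), f (b + 3), …` misses only
`f (b + 1)`. -/
theorem not_adj_add_one_add_two (hf : G.IsCycleFun L f) (hL : 4 ≤ L) (hG : ¬G.HasCycle (L - 1))
    {a b c d : ℤ} (hab : a < b) (hba : b + 2 ≤ a + L) (hc : c = a + 1) (hd : d = b + 2)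
    (h : G.Adj (f a) (f b)) : ¬G.Adj (f c) (f d) := by
  intro h'
  have h1 := hf.isPathList_descend (a := b) (b := c) (n := (b - a).toNat) (by omega) (by omega)
    (by omega)
  have h2 := hf.isPathList_ascend (a := d) (b := a + L) (n := (a + L - d + 1).toNat) (by omega)
    (by omega) (by omega)
  have h3 := h1.append h2 h' (by
    intro x hx hx'
    obtain ⟨i, hi1, hi2, rfl⟩ := mem_descend.1 hx
    obtain ⟨j, hj1, hj2, hj3⟩ := mem_ascend.1 hx'
    have := hf.inj hj3 (by omega) (by omega)
    omega)
  rw [hf.add_period] at h3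
  refine hG ?_
  have := h3.hasCycle h (by simp; omega)
  convert this using 1
  simp; omega

theorem parity (hf : G.IsCycleFun (2 * r) f) {i j : ℤ} (h : f i = f j) : i % 2 = j % 2 := by
  have := (hf.1 i j).1 h
  obtain ⟨k, hk⟩ := this
  push_cast at hk
  rw [mul_assoc] at hk
  omega

theorem two_mul_even (hf : G.IsCycleFun (2 * r) f) (hr : 2 ≤ r) (hG : ¬G.HasCycle (2 * r - 1))
    (c : ℤ) : Gᶜ.IsCycleFun r fun i => f (c + 2 * i) := by
  refine ⟨fun i j => ?_, fun i => hf.compl_adj_two (by omega) hG (by ring)⟩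
  rw [hf.1, show c + 2 * i - (c + 2 * j) = 2 * (i - j) by ring]
  push_cast
  exact mul_dvd_mul_iff_left two_ne_zero

/-- The chords of length 2 form two cycles of length `r` in the complement, one for each parity of
the index. The two given chords join one of these cycles to the other, and together they close a
cycle through all of the first and all but one vertex of the second. -/
theorem compl_not_adj_sub_two_sub_four (hf : G.IsCycleFun (2 * r) f) (hr : 3 ≤ r)
    (hG : ¬G.HasCycle (2 * r - 1)) (hG' : ¬Gᶜ.HasCycle (2 * r - 1)) {p q p' q' : ℤ}
    (hpq : (q - p) % 2 = 1) (hp : p' = p - 2) (hq : q' = q - 4) (h : Gᶜ.Adj (f p) (f q)) :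
    ¬Gᶜ.Adj (f p') (f q') := by
  intro h'
  have h1 := (hf.two_mul_even (by omega) hG p).isPathList_ascend (a := 0) (b := r - 1) (n := r)
    (by omega) (by omega) (by omega)
  have h2 := (hf.two_mul_even (by omega) hG q).isPathList_ascend (a := 0) (b := r - 2) (n := r - 1)
    (by omega) (by omega) (by omega)
  have h3 := h1.reverse.append h2 (by simpa using h) (by
    intro x hx hx'
    rw [List.mem_reverse] at hx
    obtain ⟨i, hi1, hi2, rfl⟩ := mem_ascend.1 hx
    obtain ⟨j, hj1, hj2, hj3⟩ := mem_ascend.1 hx'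
    have := hf.parity hj3
    omega)
  refine hG' ?_
  have e1 : f p' = f (p + 2 * (r - 1)) := hf.eq_of_dvd ⟨-1, by push_cast; rw [hp]; ring⟩
  have e2 : f q' = f (q + 2 * (r - 2)) := hf.eq_of_dvd ⟨-1, by push_cast; rw [hq]; ring⟩
  rw [e1, e2] at h'
  have := h3.hasCycle h'.symm (by simp; omega)
  convert this using 1
  simp; omega

/-- A chord of the cycle's color between indices of equal parity forces two chords of the other
color, to which `compl_not_adj_sub_two_sub_four` applies. -/
theorem compl_adj_even (hf : G.IsCycleFun (2 * r) f) (hr : 3 ≤ r)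
    (hG : ¬G.HasCycle (2 * r - 1)) (hG' : ¬Gᶜ.HasCycle (2 * r - 1)) {a b : ℤ} (hab : a < b)
    (hba : b < a + 2 * r) (heven : (b - a) % 2 = 0) : Gᶜ.Adj (f a) (f b) := by
  refine hf.compl_adj (by omega) (by omega) (by push_cast; omega) fun h => ?_
  have h1 := hf.not_adj_add_one_add_two (by omega) hG hab (by push_cast; omega) rfl rfl h
  have h2 : Gᶜ.Adj (f (a + 1)) (f (b + 2)) := by
    by_cases hb : b = a + 2 * r - 2
    · subst hb
      exfalso
      have e : f (a + 2 * r - 2 + 2) = f a := hf.eq_of_dvd ⟨1, by push_cast; ring⟩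
      rw [e] at h1
      exact h1 (hf.adj' rfl)
    · exact hf.compl_adj (by omega) (by push_cast; omega) (by push_cast; omega) h1
  have h3 := hf.compl_not_adj_sub_two_sub_four hr hG hG' (p' := a - 1) (q' := b - 2) (by omega)
    (by omega) (by omega) h2
  have h4 := (hf.reflect 0).not_adj_add_one_add_two (by omega) hG (a := -a) (b := 2 * r - b)
    (c := - (a - 1)) (d := 2 * r - (b - 2)) (by omega)
    (by push_cast; omega) (by ring) (by ring)
    (by
      have e : f (0 - (2 * r - b)) = f b := hf.eq_of_dvd ⟨-1, by push_cast; ring⟩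
      have e' : f (0 - -a) = f a := by congr 1; ring
      simpa only [e, e'] using h)
  have e : f (0 - (2 * r - (b - 2))) = f (b - 2) := hf.eq_of_dvd ⟨-1, by push_cast; ring⟩
  have e' : f (0 - -(a - 1)) = f (a - 1) := by congr 1; ring
  simp only [e, e'] at h4
  refine h3 (hf.compl_adj (by omega) (by push_cast; omega) (by push_cast; omega) h4)

end IsCycleFun

theorem adj_of_not_compl_adj {x y : V} (hne : x ≠ y) (h : ¬Gᶜ.Adj x y) : G.Adj x y := by
  by_contra h'
  exact h ((SimpleGraph.compl_adj _ _ _).2 ⟨hne, h'⟩)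

theorem compl_adj_of_not_adj {x y : V} (hne : x ≠ y) (h : ¬G.Adj x y) : Gᶜ.Adj x y :=
  (SimpleGraph.compl_adj _ _ _).2 ⟨hne, h⟩

section

variable [DecidableEq V]

/-- The vertices `f c, f (c + 2), f (c + 4), …` of a cycle of even length `2 * r`. -/
def alternateVerts (f : ℤ → V) (r : ℕ) (c : ℤ) : Finset V :=
  (Finset.range r).image fun i : ℕ => f (c + 2 * i)

variable {r : ℕ} {f : ℤ → V}

theorem IsCycleFun.mem_alternateVerts (hf : G.IsCycleFun (2 * r) f) (hr : 1 ≤ r) {c : ℤ} {x : V} :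
    x ∈ alternateVerts f r c ↔ ∃ i : ℤ, f (c + 2 * i) = x := by
  simp only [alternateVerts, Finset.mem_image, Finset.mem_range]
  constructor
  · rintro ⟨i, -, rfl⟩
    exact ⟨i, rfl⟩
  · rintro ⟨i, rfl⟩
    have h1 := Int.emod_nonneg i (by omega : (r : ℤ) ≠ 0)
    have h2 := Int.emod_lt_of_pos i (by omega : (0 : ℤ) < r)
    refine ⟨(i % r).toNat, by omega, hf.eq_of_dvd ⟨-(i / r), ?_⟩⟩
    rw [Int.toNat_of_nonneg h1]
    have := Int.mul_ediv_add_emod i r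
    push_cast
    linear_combination 2 * this

theorem IsCycleFun.card_alternateVerts (hf : G.IsCycleFun (2 * r) f) (c : ℤ) :
    (alternateVerts f r c).card = r := by
  rw [alternateVerts, Finset.card_image_of_injOn, Finset.card_range]
  intro i hi j hj hij
  simp only [Finset.coe_range, Set.mem_Iio] at hi hj
  have := hf.inj hij (by push_cast; omega) (by push_cast; omega)
  omega

theorem IsCycleFun.disjoint_alternateVerts (hf : G.IsCycleFun (2 * r) f) {c d : ℤ}
    (hcd : c % 2 ≠ d % 2) : Disjoint (alternateVerts f r c) (alternateVerts f r d) := by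
  rw [Finset.disjoint_left]
  intro x hx hx'
  simp only [alternateVerts, Finset.mem_image] at hx hx'
  obtain ⟨i, -, rfl⟩ := hx
  obtain ⟨j, -, hj⟩ := hx'
  have := hf.parity hj
  omega

theorem IsCycleFun.compl_adj_alternateVerts (hf : G.IsCycleFun (2 * r) f) (hr : 3 ≤ r)
    (hG : ¬G.HasCycle (2 * r - 1)) (hG' : ¬Gᶜ.HasCycle (2 * r - 1)) (c : ℤ) :
    ∀ x ∈ alternateVerts f r c, ∀ y ∈ alternateVerts f r c, x ≠ y → Gᶜ.Adj x y := by
  intro x hx y hy hxy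
  simp only [alternateVerts, Finset.mem_image, Finset.mem_range] at hx hy
  obtain ⟨i, hi, rfl⟩ := hx
  obtain ⟨j, hj, rfl⟩ := hy
  rcases lt_trichotomy i j with h | h | h
  · exact hf.compl_adj_even hr hG hG' (by omega) (by omega) (by omega)
  · subst h; exact absurd rfl hxy
  · exact (hf.compl_adj_even hr hG hG' (by omega) (by omega) (by omega)).symm

end

/-- Two disjoint cliques of size `r` joined by two disjoint edges contain a cycle of length
`2 * r - 1`. -/
theorem hasCycle_of_two_cliques {r : ℕ} (hr : 3 ≤ r) {E O : Finset V}
    (hd : Disjoint E O) (hE : ∀ x ∈ E, ∀ y ∈ E, x ≠ y → G.Adj x y)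
    (hO : ∀ x ∈ O, ∀ y ∈ O, x ≠ y → G.Adj x y) (hEr : r ≤ E.card) (hOr : r ≤ O.card)
    {x x' y y' : V} (hx : x ∈ E) (hx' : x' ∈ E) (hy : y ∈ O) (hy' : y' ∈ O) (hxx' : x ≠ x')
    (hyy' : y ≠ y') (hxy : G.Adj x y) (hxy' : G.Adj x' y') : G.HasCycle (2 * r - 1) := by
  classical
  obtain ⟨l, hl, hlen, hmem⟩ := exists_isPathList_clique (by omega : 2 ≤ r) hE hEr hx' hx hxx'.symm
  obtain ⟨l', hl', hlen', hmem'⟩ := exists_isPathList_clique (by omega : 2 ≤ r - 1) hO (by omega)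
    hy hy' hyy'
  have := (hl.append hl' hxy fun z hz hz' =>
    Finset.disjoint_left.1 hd (hmem z hz) (hmem' z hz')).hasCycle hxy'.symm (by simp; omega)
  convert this using 1
  simp; omega

/-- A cycle of even length `2 * r ≥ 6` in a graph such that neither the graph nor its complement
has a cycle of length `2 * r - 1`: the two halves of the cycle are cliques of the complement, and
the graph has all edges between them except possibly at one vertex `c`. -/
theorem exists_cliques_of_hasCycle_even {r : ℕ} (hr : 3 ≤ r) (h : G.HasCycle (2 * r))
    (hG : ¬G.HasCycle (2 * r - 1)) (hG' : ¬Gᶜ.HasCycle (2 * r - 1)) :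
    ∃ E O : Finset V, Disjoint E O ∧ E.card = r ∧ O.card = r ∧
      (∀ x ∈ E, ∀ y ∈ E, x ≠ y → Gᶜ.Adj x y) ∧ (∀ x ∈ O, ∀ y ∈ O, x ≠ y → Gᶜ.Adj x y) ∧
      ∃ c ∈ E, (∀ x ∈ E, x ≠ c → ∀ y ∈ O, G.Adj x y) ∧
        ∃ y₁ ∈ O, ∃ y₂ ∈ O, y₁ ≠ y₂ ∧ G.Adj c y₁ ∧ G.Adj c y₂ := by
  classical
  obtain ⟨-, f, hf⟩ := h
  have hd := hf.disjoint_alternateVerts (c := 0) (d := 1) (by norm_num)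
  have h0 := hf.compl_adj_alternateVerts hr hG hG' 0
  have h1 := hf.compl_adj_alternateVerts hr hG hG' 1
  have c0 := hf.card_alternateVerts 0
  have c1 := hf.card_alternateVerts 1
  have hne : ∀ x ∈ alternateVerts f r 0, ∀ y ∈ alternateVerts f r 1, x ≠ y :=
    fun x hx y hy hxy => Finset.disjoint_left.1 hd hx (hxy ▸ hy)
  have star := star_of_no_two_disjoint (X := alternateVerts f r 0) (Y := alternateVerts f r 1)
    (R := Gᶜ.Adj) (by rw [← Finset.card_pos]; omega) (by
      intro x hx x' hx' y hy y' hy' hxx' hyy' hxy hxy'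
      exact hG' (hasCycle_of_two_cliques hr hd h0 h1 c0.ge c1.ge hx hx' hy hy' hxx' hyy' hxy hxy'))
  rcases star with ⟨c, hc, hstar⟩ | ⟨c, hc, hstar⟩
  · refine ⟨_, _, hd, c0, c1, h0, h1, c, hc,
      fun x hx hxc y hy => adj_of_not_compl_adj (hne x hx y hy) (hstar x hx hxc y hy), ?_⟩
    obtain ⟨i, rfl⟩ := (hf.mem_alternateVerts (by omega)).1 hc
    refine ⟨f (2 * i + 1), (hf.mem_alternateVerts (by omega)).2 ⟨i, by ring_nf⟩,
      f (2 * i - 1), (hf.mem_alternateVerts (by omega)).2 ⟨i - 1, by ring_nf⟩,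
      hf.ne (by omega) (by omega) (by omega), hf.adj (by ring), hf.adj' (by ring)⟩
  · refine ⟨_, _, hd.symm, c1, c0, h1, h0, c, hc,
      fun y hy hyc x hx => (adj_of_not_compl_adj (hne x hx y hy) (hstar y hy hyc x hx)).symm, ?_⟩
    obtain ⟨i, rfl⟩ := (hf.mem_alternateVerts (by omega)).1 hc
    refine ⟨f (2 * i + 2), (hf.mem_alternateVerts (by omega)).2 ⟨i + 1, by ring_nf⟩,
      f (2 * i), (hf.mem_alternateVerts (by omega)).2 ⟨i, by ring_nf⟩,
      hf.ne (by omega) (by omega) (by omega), hf.adj (by ring), hf.adj' (by ring)⟩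

/-- `G` or its complement contains a cycle with exactly `L` vertices. -/
def HasMonoCycle (G : SimpleGraph V) (L : ℕ) : Prop :=
  G.HasCycle L ∨ Gᶜ.HasCycle L

theorem hasMonoCycle_compl {L : ℕ} : Gᶜ.HasMonoCycle L ↔ G.HasMonoCycle L := by
  rw [HasMonoCycle, HasMonoCycle, compl_compl, or_comm]

/-- To pass from a monochromatic cycle to a symmetric conclusion, the cycle may be assumed to lie
in the first color. -/
theorem HasMonoCycle.elim_of_symm {L : ℕ} {P : SimpleGraph V → Prop} (h : G.HasMonoCycle L)
    (hP : ∀ H : SimpleGraph V, H.HasCycle L → P H) (hsymm : P Gᶜ → P G) : P G :=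
  Or.elim h (hP G) fun h => hsymm (hP Gᶜ h)

theorem HasMonoCycle.sub_one_of_odd {L : ℕ} (hL : 7 ≤ L) (hodd : Odd L) (h : G.HasMonoCycle L) :
    G.HasMonoCycle (L - 1) :=
  h.elim_of_symm (P := fun G => G.HasMonoCycle (L - 1)) (fun _ => hasCycle_sub_one_of_odd hL hodd)
    hasMonoCycle_compl.1

theorem HasMonoCycle.sub_two_of_even {r : ℕ} (hr : 4 ≤ r) (h : G.HasMonoCycle (2 * r)) :
    G.HasMonoCycle (2 * (r - 1)) := by
  classical
  refine h.elim_of_symm (P := fun G => G.HasMonoCycle (2 * (r - 1))) (fun G h => ?_)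
    hasMonoCycle_compl.1
  by_cases h' : G.HasMonoCycle (2 * r - 1)
  · have := h'.sub_one_of_odd (by omega) ⟨r - 1, by omega⟩
    rwa [show 2 * r - 1 - 1 = 2 * (r - 1) by omega] at this
  · rw [HasMonoCycle, not_or] at h'
    obtain ⟨E, O, hd, hE, hO, -, -, c, hc, hadj, -⟩ :=
      exists_cliques_of_hasCycle_even (by omega) h h'.1 h'.2
    refine .inl (hasCycle_bipartite (A := E.erase c) (B := O) (by omega)
      (hd.mono_left (Finset.erase_subset _ _))
      (fun x hx y hy => hadj x (Finset.mem_of_mem_erase hx) (Finset.ne_of_mem_erase hx) y hy) ?_ ?_)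
    · rw [Finset.card_erase_of_mem hc, hE]
    · omega

/-- A monochromatic cycle of length at least `2 * r ≥ 6` forces one of length exactly `2 * r`. -/
theorem HasMonoCycle.to_even {r L : ℕ} (hr : 3 ≤ r) (hL : 2 * r ≤ L) (h : G.HasMonoCycle L) :
    G.HasMonoCycle (2 * r) := by
  have key : ∀ s, r ≤ s → G.HasMonoCycle (2 * s) → G.HasMonoCycle (2 * r) := by
    intro s hs
    induction s, hs using Nat.le_induction with
    | base => exact id
    | succ s hs ih => exact fun h => ih (h.sub_two_of_even (by omega))
  rcases Nat.even_or_odd' L with ⟨s, rfl | rfl⟩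
  · exact key s (by omega) h
  · exact key s (by omega) (h.sub_one_of_odd (by omega) ⟨s, rfl⟩)

/-- With at least `4 * r - 3` vertices, a monochromatic cycle of length `2 * r` forces one of length
`2 * r - 1`. Otherwise every vertex off the two cliques of
`exists_cliques_of_hasCycle_even` is joined in their color to one of them completely, and the
larger class of such vertices gives a cycle together with its clique. -/
theorem HasMonoCycle.sub_one_of_even [Fintype V] {r : ℕ} (hr : 4 ≤ r)
    (hV : 4 * r - 3 ≤ Fintype.card V) (h : G.HasMonoCycle (2 * r)) :
    G.HasMonoCycle (2 * r - 1) := by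
  classical
  refine h.elim_of_symm (P := fun G => G.HasMonoCycle (2 * r - 1)) (fun G h => ?_)
    hasMonoCycle_compl.1
  by_contra h'
  rw [HasMonoCycle, not_or] at h'
  obtain ⟨hG, hG'⟩ := h'
  obtain ⟨E, O, hd, hE, hO, hEc, hOc, c, hc, hadj, y₁, hy₁, y₂, hy₂, hy, hcy₁, hcy₂⟩ :=
    exists_cliques_of_hasCycle_even (by omega) h hG hG'
  have hd' : Disjoint (E.erase c) O := hd.mono_left (Finset.erase_subset _ _)
  have hadj' : ∀ x ∈ E.erase c, ∀ y ∈ O, G.Adj x y := fun x hx y hy =>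
    hadj x (Finset.mem_of_mem_erase hx) (Finset.ne_of_mem_erase hx) y hy
  have hcO : c ∉ O := Finset.disjoint_left.1 hd hc
  have hEe : (E.erase c).card = r - 1 := by rw [Finset.card_erase_of_mem hc, hE]
  -- A path alternating between `E` and `O` from `x` to `y`.
  have path : ∀ x ∈ E, ∀ y ∈ O, ∃ l, G.IsPathList l x y ∧ l.length = 2 * r - 2 ∧
      ∀ z ∈ l, z ∈ E ∪ O := by
    intro x hx y hyO
    by_cases hxc : x = c
    · subst hxc
      obtain ⟨y', hy', hne, hxy'⟩ : ∃ y' ∈ O, y' ≠ y ∧ G.Adj x y' := by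
        by_cases hh : y₁ = y
        · exact ⟨y₂, hy₂, by rw [← hh]; exact hy.symm, hcy₂⟩
        · exact ⟨y₁, hy₁, hh, hcy₁⟩
      obtain ⟨l, hl, hlen, hmem⟩ := exists_isPathList_bipartite_same (n := r - 2) (by omega)
        hd'.symm (fun y hy x hx => (hadj' x hx y hy).symm) (by omega) (by omega) hy' hyO hne
      refine ⟨x :: l, hl.cons hxy' fun h => ?_, by simp; omega, ?_⟩
      · have := hmem x h
        simp [hcO] at this
      · intro z hz
        rw [List.mem_cons] at hz
        rcases hz with rfl | hz
        · simp [hx]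
        · have := hmem z hz
          simp only [Finset.mem_union, Finset.mem_erase] at this ⊢
          tauto
    · obtain ⟨l, hl, hlen, hmem⟩ := exists_isPathList_bipartite (n := r - 1) (by omega)
        hd' hadj' (by omega) (by omega) (Finset.mem_erase.2 ⟨hxc, hx⟩) hyO
      refine ⟨l, hl, by omega, fun z hz => ?_⟩
      have := hmem z hz
      simp only [Finset.mem_union, Finset.mem_erase] at this ⊢
      tauto
  set Z := Finset.univ \ (E ∪ O) with hZ
  have hZcard : 2 * r - 3 ≤ Z.card := by
    rw [hZ, Finset.card_sdiff_of_subset (Finset.subset_univ _), Finset.card_union_of_disjoint hd,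
      Finset.card_univ]
    omega
  have dich : ∀ z ∈ Z, (∀ x ∈ E, Gᶜ.Adj x z) ∨ ∀ y ∈ O, Gᶜ.Adj y z := by
    intro z hz
    have hz' : z ∉ E ∪ O := by simpa [hZ] using hz
    by_contra! hcon
    obtain ⟨⟨x, hx, hxz⟩, y, hyO, hyz⟩ := hcon
    have hxz' := adj_of_not_compl_adj (by rintro rfl; simp [hx] at hz') hxz
    have hyz' := adj_of_not_compl_adj (by rintro rfl; simp [hyO] at hz') hyz
    obtain ⟨l, hl, hlen, hmem⟩ := path x hx y hyO
    have := (hl.concat hyz' fun h => hz' (hmem z h)).hasCycle hxz'.symm (by simp; omega)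
    refine hG ?_
    convert this using 1
    simp; omega
  -- A clique of size `r` completely joined to `r - 1` further vertices.
  have fin : ∀ S T : Finset V, Disjoint S T → S.card = r → r - 1 ≤ T.card →
      (∀ x ∈ S, ∀ y ∈ S, x ≠ y → Gᶜ.Adj x y) → (∀ x ∈ S, ∀ y ∈ T, Gᶜ.Adj x y) → False := by
    intro S T hST hS hT hSc hSTc
    obtain ⟨a, ha, b, hb, hab⟩ := Finset.one_lt_card.1 (by omega : 1 < S.card)
    obtain ⟨l, hl, hlen, -⟩ := exists_isPathList_bipartite_same (n := r - 1) (by omega)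
      hST hSTc (by omega) hT ha hb hab
    have := hl.hasCycle (hSc b hb a ha hab.symm) (by omega)
    refine hG' ?_
    convert this using 1
    omega
  obtain ⟨ZE, hZE⟩ : ∃ ZE, ZE = Z.filter fun z => ∀ x ∈ E, Gᶜ.Adj x z := ⟨_, rfl⟩
  have hsub : ZE ⊆ Z := hZE ▸ Finset.filter_subset _ _
  have hdisj : ∀ S ⊆ E ∪ O, ∀ T ⊆ Z, Disjoint S T := by
    intro S hS T hT
    refine Finset.disjoint_left.2 fun x hx hx' => ?_
    have := hT hx'
    rw [hZ, Finset.mem_sdiff] at this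
    exact this.2 (hS hx)
  by_cases hbig : r - 1 ≤ ZE.card
  · refine fin E ZE (hdisj E Finset.subset_union_left _ hsub) hE hbig hEc fun x hx z hz => ?_
    rw [hZE, Finset.mem_filter] at hz
    exact hz.2 x hx
  · have hcard : r - 1 ≤ (Z \ ZE).card := by
      rw [Finset.card_sdiff_of_subset hsub]; omega
    refine fin O (Z \ ZE) (hdisj O Finset.subset_union_right _ Finset.sdiff_subset) hO hcard hOc
      fun y hy z hz => ?_
    rw [Finset.mem_sdiff] at hz
    refine (dich z hz.1).resolve_left (fun h => hz.2 ?_) y hy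
    rw [hZE, Finset.mem_filter]
    exact ⟨hz.1, h⟩

/-! ### Long cycles in bipartite graphs -/

/-- Jackson's theorem on cycles through one side of a bipartite graph: if every vertex of `A` has at
least `d` neighbors in `B`, where `2 ≤ |A| ≤ d` and `|B| ≤ 2 * d - 2`, then some cycle alternates
between `A` and `B` and covers `A`. A cycle covering all of `A` except `u` can be extended
to `u`: otherwise `u` and the successors in `A` of its neighbors on the cycle have disjoint
neighborhoods off the cycle, for which `B` is too small. -/
theorem hasCycle_between [DecidableEq V] [DecidableRel G.Adj] {B : Finset V} {d n : ℕ}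
    (hn : 2 ≤ n) :
    ∀ {A : Finset V}, A.card = n → Disjoint A B → n ≤ d → B.card ≤ 2 * d - 2 →
      (∀ a ∈ A, d ≤ (B.filter (G.Adj a)).card) →
      (G.between (A : Set V) (B : Set V)).HasCycle (2 * n) := by
  induction n, hn using Nat.le_induction with
  | base =>
    intro A hA hd hnd hB hdeg
    obtain ⟨x, y, hxy, rfl⟩ := Finset.card_eq_two.1 hA
    have h1 := hdeg x (by simp)
    have h2 := hdeg y (by simp)
    have h3 := Finset.card_union_add_card_inter (B.filter (G.Adj x)) (B.filter (G.Adj y))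
    have h4 : (B.filter (G.Adj x) ∪ B.filter (G.Adj y)).card ≤ B.card := Finset.card_le_card
      (Finset.union_subset (Finset.filter_subset _ _) (Finset.filter_subset _ _))
    refine hasCycle_bipartite (A := {x, y}) (B := B.filter (G.Adj x) ∩ B.filter (G.Adj y)) le_rfl
      (hd.mono_right (Finset.inter_subset_left.trans (Finset.filter_subset _ _))) ?_ hA.ge
      (by omega)
    intro a ha b hb
    simp only [Finset.mem_inter, Finset.mem_filter] at hb
    rw [between_adj]
    refine ⟨?_, .inl ⟨by simpa using ha, by simpa using hb.1.1⟩⟩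
    simp only [Finset.mem_insert, Finset.mem_singleton] at ha
    rcases ha with rfl | rfl
    · exact hb.1.2
    · exact hb.2.2
  | succ n hn ih =>
    intro A hA hd hnd hB hdeg
    obtain ⟨u, hu⟩ : A.Nonempty := by rw [← Finset.card_pos]; omega
    obtain ⟨-, f₀, hf₀⟩ := ih (A := A.erase u) (by rw [Finset.card_erase_of_mem hu]; omega)
      (hd.mono_left (Finset.erase_subset _ _)) (by omega) hB
      fun a ha => hdeg a (Finset.mem_of_mem_erase ha)
    -- Rotate the cycle so that the vertices of `A` have even indices.
    obtain ⟨f, hf, hf0⟩ : ∃ f, (G.between ((A.erase u : Finset V) : Set V) (B : Set V)).IsCycleFun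
        (2 * n) f ∧ f 0 ∈ A.erase u := by
      rcases (between_adj.1 (hf₀.2 0)).2 with h | h
      · exact ⟨f₀, hf₀, h.1⟩
      · exact ⟨_, hf₀.shift 1, h.2⟩
    have hd' : Disjoint (A.erase u) B := hd.mono_left (Finset.erase_subset _ _)
    have stepA : ∀ {x y}, (G.between ((A.erase u : Finset V) : Set V) (B : Set V)).Adj x y →
        x ∈ A.erase u → y ∈ B := by
      intro x y hxy hx
      rcases (between_adj.1 hxy).2 with h | h
      · exact h.2
      · exact absurd h.1 (Finset.disjoint_left.1 hd' hx)
    have stepB : ∀ {x y}, (G.between ((A.erase u : Finset V) : Set V) (B : Set V)).Adj x y →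
        x ∈ B → y ∈ A.erase u := by
      intro x y hxy hx
      rcases (between_adj.1 hxy).2 with h | h
      · exact absurd hx (Finset.disjoint_left.1 hd' h.1)
      · exact h.2
    have hfA : ∀ i : ℤ, f (2 * i) ∈ A.erase u := by
      intro i
      induction i using Int.induction_on with
      | zero => simpa using hf0
      | succ i hi =>
        exact stepB (hf.adj (i := 2 * i + 1) (by ring)) (stepA (hf.2 _) hi)
      | pred i hi =>
        exact stepB (hf.adj' (i := 2 * (-i) - 1) (by ring)) (stepA (hf.adj' (by ring)) hi)
    have hfB : ∀ i : ℤ, f (2 * i + 1) ∈ B := fun i => stepA (hf.2 _) (hfA i)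
    by_contra hno
    set H := G.between (A : Set V) (B : Set V) with hH
    have hfH : H.IsCycleFun (2 * n) f := hf.mono fun x y hxy => by
      rw [between_adj] at hxy
      rw [hH, between_adj]
      refine ⟨hxy.1, hxy.2.imp (fun h => ⟨?_, h.2⟩) fun h => ⟨h.1, ?_⟩⟩
      · exact Finset.mem_of_mem_erase h.1
      · exact Finset.mem_of_mem_erase h.2
    have hadjH : ∀ {a b}, a ∈ A → b ∈ B → G.Adj a b → H.Adj a b := fun ha hb hab => by
      rw [hH, between_adj]
      exact ⟨hab, .inl ⟨ha, hb⟩⟩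
    have huB : u ∉ B := Finset.disjoint_left.1 hd hu
    have hfu : ∀ i, f i ≠ u := by
      intro i
      rcases Int.even_or_odd' i with ⟨j, rfl | rfl⟩
      · exact Finset.ne_of_mem_erase (hfA j)
      · intro h; exact huB (h ▸ hfB j)
    set C := alternateVerts f n 1 with hC
    have hCn : C.card = n := hf.card_alternateVerts 1
    have hCB : C ⊆ B := by
      intro x hx
      obtain ⟨i, rfl⟩ := (hf.mem_alternateVerts (by omega)).1 hx
      rw [add_comm]; exact hfB i
    set B₀ := B \ C with hB₀
    have hB₀card : B₀.card = B.card - n := by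
      rw [hB₀, Finset.card_sdiff_of_subset hCB, hCn]
    have hfB₀ : ∀ b ∈ B₀, ∀ i, f i ≠ b := by
      rintro b hb i rfl
      rw [hB₀, Finset.mem_sdiff] at hb
      rcases Int.even_or_odd' i with ⟨j, rfl | rfl⟩
      · exact Finset.disjoint_left.1 hd' (hfA j) hb.1
      · exact hb.2 ((hf.mem_alternateVerts (by omega)).2 ⟨j, by rw [add_comm]⟩)
    have hB₀B : ∀ b ∈ B₀, b ∈ B := fun b hb => (Finset.mem_sdiff.1 hb).1
    have hub : ∀ b ∈ B₀, b ≠ u := by rintro b hb rfl; exact huB (hB₀B b hb)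
    set P := (Finset.range n).filter fun i : ℕ => G.Adj u (f (1 + 2 * i)) with hP
    -- Off-cycle neighborhoods.
    let M : V → Finset V := fun x => B₀.filter (G.Adj x)
    have hMle : ∀ x, (B.filter (G.Adj x)).card ≤ (M x).card + n := by
      intro x
      rw [← hCn]
      refine (Finset.card_le_card ?_).trans (Finset.card_union_le _ _)
      intro y hy
      simp only [M, hB₀, Finset.mem_union, Finset.mem_filter, Finset.mem_sdiff] at hy ⊢
      tauto
    have hMu : (B.filter (G.Adj u)).card ≤ (M u).card + P.card := by
      have : B.filter (G.Adj u) ⊆ M u ∪ P.image fun i : ℕ => f (1 + 2 * i) := by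
        intro y hy
        rw [Finset.mem_filter] at hy
        by_cases hyC : y ∈ C
        · rw [hC, alternateVerts, Finset.mem_image] at hyC
          obtain ⟨i, hi, rfl⟩ := hyC
          refine Finset.mem_union_right _ (Finset.mem_image.2 ⟨i, ?_, rfl⟩)
          exact Finset.mem_filter.2 ⟨hi, hy.2⟩
        · refine Finset.mem_union_left _ (Finset.mem_filter.2 ⟨?_, hy.2⟩)
          exact Finset.mem_sdiff.2 ⟨hy.1, hyC⟩
      exact (Finset.card_le_card this).trans ((Finset.card_union_le _ _).trans
        (Nat.add_le_add_left Finset.card_image_le _))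
    have hdu := hdeg u hu
    have hMsub : ∀ x, M x ⊆ B₀ := fun x => Finset.filter_subset _ _
    have hMmem : ∀ {x b}, b ∈ M x → b ∈ B₀ ∧ G.Adj x b := fun h => Finset.mem_filter.1 h
    have hsucc : ∀ i : ℤ, f (2 * i) ∈ A := fun i => Finset.mem_of_mem_erase (hfA i)
    by_cases hP0 : P.card = 0
    · -- `u` shares two off-cycle neighbors with every vertex of `A` on the cycle.
      have common : ∀ i : ℤ, 1 < (M u ∩ M (f (2 * i))).card := by
        intro i
        have h1 := Finset.card_union_add_card_inter (M u) (M (f (2 * i)))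
        have h2 : (M u ∪ M (f (2 * i))).card ≤ B₀.card :=
          Finset.card_le_card (Finset.union_subset (hMsub _) (hMsub _))
        have h3 := hMle (f (2 * i))
        have h4 := hdeg _ (hsucc i)
        have h5 : n ≤ B.card := hCn ▸ Finset.card_le_card hCB
        omega
      obtain ⟨b, hb⟩ := Finset.card_pos.1 ((Nat.zero_lt_one).trans (common 0))
      obtain ⟨b', hb', hne⟩ := Finset.exists_mem_ne (common 1) b
      rw [Finset.mem_inter] at hb hb'
      have h1 := hMmem hb.1
      have h2 := hMmem hb.2
      have h3 := hMmem hb'.1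
      have h4 := hMmem hb'.2
      refine hno (hfH.hasCycle_bridge (a := 2 * 0) (b := 2 * 1) (d := 2) (by norm_num) (by omega)
        (by omega) (l := [b, u, b']) (s := b) (t := b')
        (((IsPathList.singleton b').cons (hadjH hu (hB₀B _ h3.1) h3.2)
          (by simpa using (hub _ h3.1).symm)).cons (hadjH hu (hB₀B _ h1.1) h1.2).symm
          (by simp [hub _ h1.1, hne.symm])) ?_ (hadjH (hsucc _) (hB₀B _ h2.1) h2.2)
        (hadjH (hsucc _) (hB₀B _ h4.1) h4.2).symm (by simp; omega) (by omega))
      intro i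
      simp [hfB₀ _ h1.1 i, hfB₀ _ h3.1 i, hfu i]
    · have dis1 : ∀ i ∈ P, Disjoint (M u) (M (f (2 * (i + 1 : ℤ)))) := by
        intro i hi
        rw [Finset.disjoint_left]
        intro b hb hb'
        have h1 := hMmem hb
        have h2 := hMmem hb'
        refine hno (hfH.hasCycle_bridge (a := 1 + 2 * i) (b := 2 * (i + 1)) (d := 1) (by ring)
          le_rfl (by omega) (.pair (hadjH hu (hB₀B _ h1.1) h1.2)) ?_
          (hadjH hu (by rw [add_comm]; exact hfB i) (Finset.mem_filter.1 hi).2).symm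
          (hadjH (hsucc _) (hB₀B _ h2.1) h2.2).symm (by simp; omega) (by omega))
        intro j
        simp [hfB₀ _ h1.1 j, hfu j]
      have key : ∀ i ∈ P, ∀ j ∈ P, i < j →
          Disjoint (M (f (2 * (i + 1 : ℤ)))) (M (f (2 * (j + 1 : ℤ)))) := by
        intro i hi j hj hij
        rw [Finset.disjoint_left]
        intro b hb hb'
        have h1 := hMmem hb
        have h2 := hMmem hb'
        have h3 := (Finset.mem_filter.1 hi)
        have h4 := (Finset.mem_filter.1 hj)
        rw [Finset.mem_range] at h3 h4
        refine hno (hfH.hasCycle_cross (s := 1 + 2 * i) (t := 1 + 2 * j) (by omega)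
          (by push_cast; omega) hfu (hadjH hu (by rw [add_comm]; exact hfB i) h3.2)
          (hadjH hu (by rw [add_comm]; exact hfB j) h4.2) (hfB₀ b h1.1) (hub b h1.1) ?_ ?_)
        · rw [show (1 + 2 * i + 1 : ℤ) = 2 * (i + 1) by ring]
          exact (hadjH (hsucc _) (hB₀B _ h1.1) h1.2).symm
        · rw [show (1 + 2 * j + 1 : ℤ) = 2 * (j + 1) by ring]
          exact (hadjH (hsucc _) (hB₀B _ h2.1) h2.2).symm
      have dis2 : (P : Set ℕ).PairwiseDisjoint fun i : ℕ => M (f (2 * (i + 1 : ℤ))) := by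
        intro i hi j hj hij
        rcases lt_or_gt_of_ne hij with h | h
        · exact key i hi j hj h
        · exact (key j hj i hi h).symm
      have hsum : (M u).card + ∑ i ∈ P, (M (f (2 * (i + 1 : ℤ)))).card ≤ B₀.card := by
        rw [← Finset.card_biUnion dis2, ← Finset.card_union_of_disjoint]
        · exact Finset.card_le_card (Finset.union_subset (hMsub _)
            (Finset.biUnion_subset.2 fun i _ => hMsub _))
        · rw [Finset.disjoint_biUnion_right]
          exact dis1
      have hlow : P.card * (d - n) ≤ ∑ i ∈ P, (M (f (2 * (i + 1 : ℤ)))).card := by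
        rw [← smul_eq_mul]
        refine Finset.card_nsmul_le_sum _ _ _ fun i _ => ?_
        have h3 := hMle (f (2 * (i + 1 : ℤ)))
        have h4 := hdeg _ (hsucc (i + 1))
        omega
      obtain ⟨g, rfl⟩ : ∃ g, d = n + 1 + g := ⟨d - (n + 1), by omega⟩
      obtain ⟨p, hp⟩ : ∃ p, P.card = p + 1 := ⟨P.card - 1, by omega⟩
      rw [show n + 1 + g - n = g + 1 by omega, hp] at hlow
      have h5 : n ≤ B.card := hCn ▸ Finset.card_le_card hCB
      rw [show (p + 1) * (g + 1) = p * g + p + g + 1 by ring] at hlow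
      have := Nat.zero_le (p * g)
      omega

/-! ### A configuration forcing a long monochromatic cycle -/

theorem IsPathList.two_le_length {l : List V} {a b : V} (h : G.IsPathList l a b) (hab : a ≠ b) :
    2 ≤ l.length := by
  obtain ⟨-, -, h3, h4⟩ := h
  match l with
  | [] => simp at h3
  | [x] => simp at h3 h4; exact absurd (h3.symm.trans h4) hab
  | _ :: _ :: _ => simp

section

variable [DecidableEq V]

/-- If `K` is completely joined to `T`, where `|K| ≥ k - 1` and `|T| ≥ k + 1`, then two edges
inside `T` suffice for a cycle of length `2 * k`. If they share a vertex, then the cycle runs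
through both in succession; otherwise it runs through them separately. -/
theorem hasCycle_of_two_edges {k : ℕ} (hk : 3 ≤ k) {K T : Finset V} (hd : Disjoint K T)
    (hadj : ∀ x ∈ T, ∀ y ∈ K, G.Adj x y) (hK : k - 1 ≤ K.card) (hT : k + 1 ≤ T.card)
    {p q w w' : V} (hp : p ∈ T) (hq : q ∈ T) (hw : w ∈ T) (hw' : w' ∈ T) (hpq : p ≠ q)
    (hww' : w ≠ w') (hwp : w ≠ p) (hwq : w ≠ q) (hwp' : w' ≠ p) (hwq' : w' ≠ q)
    (h : G.Adj w p ∨ G.Adj w q) (h' : G.Adj w' p ∨ G.Adj w' q) : G.HasCycle (2 * k) := by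
  have same : ∀ r ∈ T, w ≠ r → w' ≠ r → G.Adj w r → G.Adj w' r → G.HasCycle (2 * k) := by
    intro r hr hwr hwr' h h'
    obtain ⟨l, hl, hlen, hmem⟩ := exists_isPathList_bipartite_same (G := G) (n := k - 1) (by omega)
      (A := T.erase r) (B := K) (hd.symm.mono_left (Finset.erase_subset _ _))
      (fun x hx y hy => hadj x (Finset.mem_of_mem_erase hx) y hy)
      (by rw [Finset.card_erase_of_mem hr]; omega) hK
      (Finset.mem_erase.2 ⟨hwr, hw⟩) (Finset.mem_erase.2 ⟨hwr', hw'⟩) hww'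
    have hrl : r ∉ l := fun hrl => by
      have := hmem r hrl
      simp only [Finset.mem_union, Finset.mem_erase, ne_eq, not_true_eq_false, false_and,
        false_or] at this
      exact Finset.disjoint_left.1 hd this hr
    have := (hl.concat h' hrl).hasCycle h.symm (by simp; omega)
    convert this using 1
    simp; omega
  have diff : ∀ r ∈ T, ∀ r' ∈ T, r ≠ r' → w ≠ r → w' ≠ r → w ≠ r' → w' ≠ r' →
      G.Adj w r → G.Adj w' r' → G.HasCycle (2 * k) := by
    intro r hr r' hr' hrr hwr hwr' hw'r hw'r' h h'
    obtain ⟨κ, hκ⟩ : K.Nonempty := by rw [← Finset.card_pos]; omega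
    have hκT := Finset.disjoint_left.1 hd hκ
    obtain ⟨l, hl, hlen, hmem⟩ := exists_isPathList_bipartite_same (G := G) (n := k - 2) (by omega)
      (A := (T.erase w).erase w') (B := K.erase κ)
      (hd.symm.mono ((Finset.erase_subset _ _).trans (Finset.erase_subset _ _))
        (Finset.erase_subset _ _))
      (fun x hx y hy => hadj x (Finset.mem_of_mem_erase (Finset.mem_of_mem_erase hx)) y
        (Finset.mem_of_mem_erase hy))
      (by rw [Finset.card_erase_of_mem (by simp [hww'.symm, hw']), Finset.card_erase_of_mem hw]
          omega)
      (by rw [Finset.card_erase_of_mem hκ]; omega) (a := r) (a' := r')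
      (by simp [hr, hwr.symm, hwr'.symm]) (by simp [hr', hw'r.symm, hw'r'.symm]) hrr
    have hwK : ∀ x ∈ T, x ∉ K := fun x hx hxK => Finset.disjoint_left.1 hd hxK hx
    have hwl : w ∉ l := fun hwl => by simpa [hwK w hw] using hmem w hwl
    have hwl' : w' ∉ l := fun hwl => by simpa [hwK w' hw'] using hmem w' hwl
    have hκl : κ ∉ l := fun hκl => by simpa [hκT] using hmem κ hκl
    have hκw : κ ≠ w := by rintro rfl; exact hκT hw
    have hκw' : κ ≠ w' := by rintro rfl; exact hκT hw'
    have := (((hl.cons h hwl).concat h'.symm (c := w') (by simp [hww'.symm, hwl'])).concat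
      (hadj w' hw' κ hκ) (by simp [hκw, hκl, hκw'])).hasCycle (hadj w hw κ hκ).symm
      (by simp)
    convert this using 1
    simp; omega
  rcases h with h | h <;> rcases h' with h' | h'
  · exact same p hp hwp hwp' h h'
  · exact diff p hp q hq hpq hwp hwp' hwq hwq' h h'
  · exact diff q hq p hp hpq.symm hwq hwq' hwp hwp' h h'
  · exact same q hq hwq hwq' h h'

/-- If `K` is completely joined to `T`, where `|K| ≥ k - 1` and `|T| ≥ k`, and `T` contains an edge,
then any two vertices of `K ∪ T` are the ends of a path with at least `2 * k - 2` vertices. -/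
theorem exists_long_isPathList_of_edge {k : ℕ} (hk : 3 ≤ k) {K T : Finset V} (hd : Disjoint K T)
    (hadj : ∀ x ∈ T, ∀ y ∈ K, G.Adj x y) (hK : k - 1 ≤ K.card) (hT : k ≤ T.card)
    {w r : V} (hw : w ∈ T) (hr : r ∈ T) (hwr : G.Adj w r) {a b : V} (ha : a ∈ K ∪ T)
    (hb : b ∈ K ∪ T) (hab : a ≠ b) :
    ∃ l, G.IsPathList l a b ∧ 2 * k - 2 ≤ l.length ∧ ∀ x ∈ l, x ∈ K ∪ T := by
  have hadj' : ∀ y ∈ K, ∀ x ∈ T, G.Adj y x := fun y hy x hx => (hadj x hx y hy).symm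
  rw [Finset.mem_union] at ha hb
  rcases ha with ha | ha <;> rcases hb with hb | hb
  · have hwK : w ∉ K := fun h => Finset.disjoint_left.1 hd h hw
    have haT : a ∉ T := Finset.disjoint_left.1 hd ha
    obtain ⟨l, hl, hlen, hmem⟩ := exists_isPathList_bipartite (G := G) (n := k - 2) (by omega)
      (A := T.erase w) (B := K.erase a)
      (hd.symm.mono (Finset.erase_subset _ _) (Finset.erase_subset _ _))
      (fun x hx y hy => hadj x (Finset.mem_of_mem_erase hx) y (Finset.mem_of_mem_erase hy))
      (by rw [Finset.card_erase_of_mem hw]; omega) (by rw [Finset.card_erase_of_mem ha]; omega)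
      (a := r) (b := b) (by simp [hr, hwr.ne']) (by simp [hb, hab.symm])
    have hwl : w ∉ l := fun h => by simpa [hwK] using hmem w h
    have hal : a ∉ l := fun h => by simpa [haT] using hmem a h
    have haw : a ≠ w := by rintro rfl; exact haT hw
    refine ⟨a :: w :: l, (hl.cons hwr hwl).cons (hadj' a ha w hw) (by simp [haw, hal]),
      by simp; omega, fun x hx => ?_⟩
    simp only [List.mem_cons] at hx
    rcases hx with rfl | rfl | hx
    · simp [ha]
    · simp [hw]
    · have := hmem x hx
      simp only [Finset.mem_union, Finset.mem_erase] at this ⊢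
      tauto
  · obtain ⟨l, hl, hlen, hmem⟩ := exists_isPathList_bipartite (n := k - 1) (by omega) hd hadj'
      hK (by omega) ha hb
    exact ⟨l, hl, by omega, hmem⟩
  · obtain ⟨l, hl, hlen, hmem⟩ := exists_isPathList_bipartite (n := k - 1) (by omega) hd.symm hadj
      (by omega) hK ha hb
    exact ⟨l, hl, by omega, fun x hx => Finset.union_comm T K ▸ hmem x hx⟩
  · obtain ⟨l, hl, hlen, hmem⟩ := exists_isPathList_bipartite_same (n := k - 1) (by omega)
      hd.symm hadj (by omega) hK ha hb hab
    exact ⟨l, hl, by omega, fun x hx => Finset.union_comm T K ▸ hmem x hx⟩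

end

/-- Consider `3 * k - 1` vertices: sets `K`, `O`, `W` of size `k - 1` and two vertices `p`, `q`
joined to `K`. Suppose that every vertex of `W` is joined to all of `K` or to all of `O`, and also
to `p` or to `q`. Then `G` or its complement has a cycle of length at least `2 * k`.

Put the vertices of `W` joined to `O` on the side of `O`, and all others with `p` and `q` on the
side of `K`. If all of `W` is on the side of `K`, then `hasCycle_of_two_edges` applies. Otherwise
both sides contain a complete bipartite graph, so two disjoint edges of `G` between them close a
long cycle. Without such edges the complement contains a large complete bipartite graph. -/
theorem exists_long_monoCycle_of_configuration {k : ℕ} (hk : 3 ≤ k) {K O W : Finset V} {p q : V}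
    (hK : K.card = k - 1) (hO : O.card = k - 1) (hW : W.card = k - 1) (hKO : Disjoint K O)
    (hKW : Disjoint K W) (hOW : Disjoint O W) (hpK : p ∉ K) (hpO : p ∉ O) (hpW : p ∉ W)
    (hqK : q ∉ K) (hqO : q ∉ O) (hqW : q ∉ W) (hpq : p ≠ q) (hKp : ∀ x ∈ K, G.Adj p x)
    (hKq : ∀ x ∈ K, G.Adj q x)
    (hWKO : ∀ w ∈ W, (∀ x ∈ K, G.Adj w x) ∨ ∀ y ∈ O, G.Adj w y)
    (hWpq : ∀ w ∈ W, G.Adj w p ∨ G.Adj w q) : ∃ L, 2 * k ≤ L ∧ G.HasMonoCycle L := by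
  classical
  obtain ⟨WO, hWO⟩ : ∃ WO, WO = W.filter fun w => ∀ y ∈ O, G.Adj w y := ⟨_, rfl⟩
  have hWOW : WO ⊆ W := hWO ▸ Finset.filter_subset _ _
  have hWOadj : ∀ w ∈ WO, ∀ y ∈ O, G.Adj w y := fun w hw => by
    rw [hWO, Finset.mem_filter] at hw
    exact hw.2
  have hWEadj : ∀ w ∈ W \ WO, ∀ x ∈ K, G.Adj w x := fun w hw => by
    rw [Finset.mem_sdiff, hWO, Finset.mem_filter] at hw
    exact (hWKO w hw.1).resolve_right fun h => hw.2 ⟨hw.1, h⟩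
  obtain ⟨t, ht⟩ : ∃ t, WO.card = t := ⟨_, rfl⟩
  have htk : t ≤ k - 1 := by rw [← ht, ← hW]; exact Finset.card_le_card hWOW
  obtain ⟨T, hT⟩ : ∃ T, T = insert p (insert q (W \ WO)) := ⟨_, rfl⟩
  have hTcard : T.card = k + 1 - t := by
    rw [hT, Finset.card_insert_of_notMem (by simp [hpq, hpW]),
      Finset.card_insert_of_notMem (by simp [hqW]), Finset.card_sdiff_of_subset hWOW]
    omega
  have hTadj : ∀ x ∈ T, ∀ y ∈ K, G.Adj x y := by
    intro x hx
    rw [hT, Finset.mem_insert, Finset.mem_insert] at hx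
    rcases hx with rfl | rfl | hx
    · exact hKp
    · exact hKq
    · exact hWEadj x hx
  have hKT : Disjoint K T := by
    rw [Finset.disjoint_left]
    intro x hx hxT
    rw [hT, Finset.mem_insert, Finset.mem_insert, Finset.mem_sdiff] at hxT
    rcases hxT with rfl | rfl | hxT
    · exact hpK hx
    · exact hqK hx
    · exact Finset.disjoint_left.1 hKW hx hxT.1
  have hpT : p ∈ T := by simp [hT]
  have hqT : q ∈ T := by simp [hT]
  have hWT : ∀ w ∈ W, w ∉ WO → w ∈ T := fun w hw hw' => by simp [hT, hw, hw']
  have hOWO : Disjoint O WO := hOW.mono_right hWOW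
  have hXY : Disjoint (K ∪ T) (O ∪ WO) := by
    rw [Finset.disjoint_left]
    intro x hx hy
    simp only [hT, Finset.mem_union, Finset.mem_insert, Finset.mem_sdiff] at hx hy
    rw [Finset.disjoint_left] at hKO hKW hOW
    rcases hx with hx | rfl | rfl | hx <;> rcases hy with hy | hy
    · exact hKO hx hy
    · exact hKW hx (hWOW hy)
    · exact hpO hy
    · exact hpW (hWOW hy)
    · exact hqO hy
    · exact hqW (hWOW hy)
    · exact hOW hy hx.1
    · exact hx.2 hy
  have hXcard : (K ∪ T).card = 2 * k - t := by
    rw [Finset.card_union_of_disjoint hKT]; omega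
  have hYcard : (O ∪ WO).card = k - 1 + t := by
    rw [Finset.card_union_of_disjoint hOWO]; omega
  rcases Nat.eq_zero_or_pos t with h0 | hpos
  · have hWOe : WO = ∅ := by rw [← Finset.card_eq_zero]; omega
    obtain ⟨w, hw, w', hw', hww'⟩ := Finset.one_lt_card.1 (by omega : 1 < W.card)
    have hnp : ∀ w ∈ W, w ≠ p := by rintro w hw rfl; exact hpW hw
    have hnq : ∀ w ∈ W, w ≠ q := by rintro w hw rfl; exact hqW hw
    exact ⟨2 * k, le_rfl, .inl (hasCycle_of_two_edges hk hKT hTadj hK.ge (by omega) hpT hqT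
      (hWT w hw (by simp [hWOe])) (hWT w' hw' (by simp [hWOe])) hpq hww' (hnp w hw) (hnq w hw)
      (hnp w' hw') (hnq w' hw') (hWpq w hw) (hWpq w' hw'))⟩
  by_contra hno
  have hKTadj : ∀ y ∈ K, ∀ x ∈ T, G.Adj y x := fun y hy x hx => (hTadj x hx y hy).symm
  have hOadj : ∀ y ∈ O, ∀ w ∈ WO, G.Adj y w := fun y hy w hw => (hWOadj w hw y hy).symm
  -- Paths on the two sides that are long enough together.
  have paths : ∃ a b, 2 * k ≤ a + b ∧
      (∀ x ∈ K ∪ T, ∀ x' ∈ K ∪ T, x ≠ x' →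
        ∃ l, G.IsPathList l x x' ∧ a ≤ l.length ∧ ∀ z ∈ l, z ∈ K ∪ T) ∧
      ∀ y ∈ O ∪ WO, ∀ y' ∈ O ∪ WO, y ≠ y' →
        ∃ l, G.IsPathList l y y' ∧ b ≤ l.length ∧ ∀ z ∈ l, z ∈ O ∪ WO := by
    by_cases h1 : t = 1
    · obtain ⟨w, hw⟩ : (W \ WO).Nonempty := by
        rw [← Finset.card_pos, Finset.card_sdiff_of_subset hWOW]; omega
      rw [Finset.mem_sdiff] at hw
      obtain ⟨r, hr, hwr⟩ : ∃ r ∈ T, G.Adj w r := by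
        rcases hWpq w hw.1 with h | h
        · exact ⟨p, hpT, h⟩
        · exact ⟨q, hqT, h⟩
      refine ⟨2 * k - 2, 2, by omega, fun x hx x' hx' hne =>
        exists_long_isPathList_of_edge hk hKT hTadj hK.ge (by omega) (hWT w hw.1 hw.2) hr hwr
          hx hx' hne, fun y hy y' hy' hne => ?_⟩
      obtain ⟨l, hl, -, hmem⟩ := exists_long_isPathList_bipartite (s := 1) le_rfl hOWO hOadj
        (by omega) (by omega) hy hy' hne
      exact ⟨l, hl, hl.two_le_length hne, hmem⟩
    · refine ⟨2 * (k + 1 - t) - 1, 2 * t - 1, by omega, fun x hx x' hx' hne =>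
        exists_long_isPathList_bipartite (by omega) hKT hKTadj (by omega) (by omega) hx hx' hne,
        fun y hy y' hy' hne =>
        exists_long_isPathList_bipartite (by omega) hOWO hOadj (by omega) (by omega) hy hy' hne⟩
  obtain ⟨a, b, hab, pathX, pathY⟩ := paths
  have star := star_of_no_two_disjoint (X := K ∪ T) (Y := O ∪ WO) (R := G.Adj) ⟨p, by simp [hpT]⟩
    (by
      intro x hx x' hx' y hy y' hy' hxx' hyy' hxy hxy'
      obtain ⟨l, hl, hlen, hmem⟩ := pathX x' hx' x hx hxx'.symm
      obtain ⟨l', hl', hlen', hmem'⟩ := pathY y hy y' hy' hyy'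
      have := (hl.append hl' hxy fun z hz hz' =>
        Finset.disjoint_left.1 hXY (hmem z hz) (hmem' z hz')).hasCycle hxy'.symm (by simp; omega)
      exact hno ⟨_, by simp; omega, .inl this⟩)
  have hne : ∀ x ∈ K ∪ T, ∀ y ∈ O ∪ WO, x ≠ y := fun x hx y hy hxy =>
    Finset.disjoint_left.1 hXY hx (hxy ▸ hy)
  rcases star with ⟨c, hc, hstar⟩ | ⟨c, hc, hstar⟩
  · refine hno ⟨2 * k, le_rfl, .inr (hasCycle_bipartite (A := (K ∪ T).erase c) (by omega)
      (hXY.mono_left (Finset.erase_subset _ _)) (fun x hx y hy => ?_)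
      (by rw [Finset.card_erase_of_mem hc]; omega) (by omega))⟩
    rw [Finset.mem_erase] at hx
    exact compl_adj_of_not_adj (hne x hx.2 y hy) (hstar x hx.2 hx.1 y hy)
  · have hred : ∀ x ∈ K ∪ T, ∀ y ∈ (O ∪ WO).erase c, Gᶜ.Adj x y := fun x hx y hy => by
      rw [Finset.mem_erase] at hy
      exact compl_adj_of_not_adj (hne x hx y hy.2) (hstar y hy.2 hy.1 x hx)
    have hdis : Disjoint (K ∪ T) ((O ∪ WO).erase c) := hXY.mono_right (Finset.erase_subset _ _)
    have hYe : ((O ∪ WO).erase c).card = k - 2 + t := by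
      rw [Finset.card_erase_of_mem hc]; omega
    by_cases h2 : 2 ≤ t
    · exact hno ⟨2 * k, le_rfl, .inr (hasCycle_bipartite (by omega) hdis hred (by omega)
        (by omega))⟩
    · by_cases hS : 1 < ((K ∪ T).filter fun x => ¬G.Adj c x).card
      · obtain ⟨x, hx, x', hx', hxx'⟩ := Finset.one_lt_card.1 hS
        rw [Finset.mem_filter] at hx hx'
        obtain ⟨l, hl, hlen, hmem⟩ := exists_isPathList_bipartite_same (n := k - 1) (by omega)
          hdis hred (by omega) (by omega) hx.1 hx'.1 hxx'
        have hcl : c ∉ l := fun h => by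
          have := hmem c h
          rw [Finset.mem_union] at this
          rcases this with h | h
          · exact hne c h c hc rfl
          · exact Finset.notMem_erase _ _ h
        have := (hl.concat (compl_adj_of_not_adj (hne _ hx'.1 c hc) fun h => hx'.2 h.symm)
          hcl).hasCycle (compl_adj_of_not_adj (hne _ hx.1 c hc).symm hx.2) (by simp; omega)
        exact hno ⟨_, by simp; omega, .inr this⟩
      · have hTc : 1 < (T.filter (G.Adj c)).card := by
          have h1 := Finset.card_filter_add_card_filter_not (s := T) (G.Adj c)
          have h2 : (T.filter fun x => ¬G.Adj c x).card ≤
              ((K ∪ T).filter fun x => ¬G.Adj c x).card :=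
            Finset.card_le_card (Finset.filter_subset_filter _ Finset.subset_union_right)
          omega
        obtain ⟨x, hx, x', hx', hxx'⟩ := Finset.one_lt_card.1 hTc
        rw [Finset.mem_filter] at hx hx'
        obtain ⟨l, hl, hlen, hmem⟩ := exists_isPathList_bipartite_same (n := k - 1) (by omega)
          hKT.symm hTadj (by omega) (by omega) hx.1 hx'.1 hxx'
        have hcl : c ∉ l := fun h =>
          hne c (Finset.union_comm T K ▸ hmem c h) c hc rfl
        have := (hl.concat hx'.2.symm hcl).hasCycle hx.2 (by simp; omega)
        exact hno ⟨_, by simp; omega, .inl this⟩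

/-! ### A monochromatic cycle through two thirds of the vertices -/

theorem div_two_le_count {P : ℕ → Prop} [DecidablePred P] :
    ∀ {n : ℕ}, (∀ i, i + 1 < n → P i ∨ P (i + 1)) → n / 2 ≤ Nat.count P n
  | 0, _ => by simp
  | 1, _ => by simp
  | n + 2, h => by
    have ih := div_two_le_count (n := n) fun i hi => h i (by omega)
    have := h n (by omega)
    rw [Nat.count_succ, Nat.count_succ]
    split_ifs <;> first | omega | tauto

section

variable [DecidableEq V]

/-- The vertices of a cycle. -/
def cycleVerts (f : ℤ → V) (L : ℕ) : Finset V :=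
  (Finset.range L).image fun i : ℕ => f i

variable {L : ℕ} {f : ℤ → V}

theorem IsCycleFun.mem_cycleVerts (hf : G.IsCycleFun L f) (hL : 1 ≤ L) {x : V} :
    x ∈ cycleVerts f L ↔ ∃ i, f i = x := by
  simp only [cycleVerts, Finset.mem_image, Finset.mem_range]
  constructor
  · rintro ⟨i, -, rfl⟩
    exact ⟨i, rfl⟩
  · rintro ⟨i, rfl⟩
    have h1 := Int.emod_nonneg i (by omega : (L : ℤ) ≠ 0)
    have h2 := Int.emod_lt_of_pos i (by omega : (0 : ℤ) < L)
    refine ⟨(i % L).toNat, by omega, hf.eq_of_dvd ⟨-(i / L), ?_⟩⟩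
    rw [Int.toNat_of_nonneg h1]
    have := Int.mul_ediv_add_emod i L
    linear_combination this

theorem IsCycleFun.card_filter_cycleVerts (hf : G.IsCycleFun L f) (hL : 1 ≤ L) (Q : V → Prop)
    [DecidablePred Q] (c : ℤ) :
    ((cycleVerts f L).filter Q).card = Nat.count (fun i : ℕ => Q (f (i + c))) L := by
  have h : cycleVerts f L = cycleVerts (fun i => f (i + c)) L := by
    ext x
    rw [hf.mem_cycleVerts hL, (hf.shift c).mem_cycleVerts hL]
    constructor
    · rintro ⟨i, rfl⟩
      exact ⟨i - c, by simp⟩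
    · rintro ⟨i, rfl⟩
      exact ⟨_, rfl⟩
  rw [h, cycleVerts, Finset.filter_image, Finset.card_image_of_injOn,
    Nat.count_eq_card_filter_range]
  intro i hi j hj hij
  simp only [Finset.coe_filter, Finset.mem_range, Set.mem_ofPred_eq] at hi hj
  have := (hf.shift c).inj hij (by omega) (by omega)
  omega

theorem IsCycleFun.card_cycleVerts (hf : G.IsCycleFun L f) : (cycleVerts f L).card = L := by
  rw [cycleVerts, Finset.card_image_of_injOn, Finset.card_range]
  intro i hi j hj hij
  simp only [Finset.coe_range, Set.mem_Iio] at hi hj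
  have := hf.inj hij (by omega) (by omega)
  omega

end

namespace IsCycleFun

variable {L : ℕ} {f : ℤ → V}

/-- A vertex outside a cycle with two consecutive neighbors on it can be inserted. -/
theorem not_adj_consecutive (hf : G.IsCycleFun L f) (hL : 2 ≤ L) (hG : ¬G.HasCycle (L + 1)) {u : V}
    (hu : ∀ i, f i ≠ u) {i j : ℤ} (hij : j = i + 1) (h : G.Adj u (f i)) : ¬G.Adj u (f j) := by
  intro h'
  exact hG (hf.hasCycle_bridge (d := 1) (by simpa using hij) le_rfl (by omega)
    (.singleton u) (by simpa using hu) h.symm h' (by simp) (by omega))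

/-- The cycle `f e, …, f (o - 2), u, f (e - 1), f (e - 2), …, f o, w` misses only `f (o - 1)`. -/
theorem hasCycle_detour (hf : G.IsCycleFun L f) {e o : ℤ} (heo : e + 2 ≤ o) (hoe : o < e + L)
    {u w : V} (hu : ∀ i, f i ≠ u) (hw : ∀ i, f i ≠ w) (huw : u ≠ w) (h1 : G.Adj u (f (o - 2)))
    (h2 : G.Adj u (f (e - 1))) (h3 : G.Adj w (f e)) (h4 : G.Adj w (f o)) :
    G.HasCycle (L + 1) := by
  have p1 := hf.isPathList_ascend (a := e) (b := o - 2) (n := (o - 1 - e).toNat) (by omega)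
    (by omega) (by omega)
  have p2 := hf.isPathList_descend (a := e - 1) (b := o - L) (n := (e - o + L).toNat) (by omega)
    (by omega) (by omega)
  rw [hf.sub_period] at p2
  have p3 := (p1.concat h1.symm (c := u) (by
      rw [mem_ascend]; rintro ⟨i, -, -, h⟩; exact hu i h)).append p2 h2 (by
    intro x hx hx'
    obtain ⟨j, hj1, hj2, rfl⟩ := mem_descend.1 hx'
    rw [List.mem_append, mem_ascend] at hx
    rcases hx with ⟨i, hi1, hi2, hi3⟩ | hx
    · have := hf.inj hi3 (by omega) (by omega)
      omega
    · exact hu j (by simpa using hx))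
  have p4 := (p3.concat h4.symm (c := w) (by
    simp only [List.mem_append, mem_ascend, mem_descend, List.mem_singleton]
    rintro ((⟨i, -, -, h⟩ | h) | ⟨i, -, -, h⟩)
    · exact hw i h
    · exact huw h.symm
    · exact hw i h)).hasCycle h3 (by simp; omega)
  convert p4 using 1
  simp; omega

/-- On a cycle of even length `2 * r`, a vertex outside with no two consecutive neighbors and at
most `r` non-neighbors has exactly every second vertex as a neighbor. -/
theorem adj_succ_iff_of_card_le [DecidableEq V] [DecidableRel Gᶜ.Adj] {r : ℕ} (hr : 1 ≤ r)
    (hf : G.IsCycleFun (2 * r) f) (hG : ¬G.HasCycle (2 * r + 1)) {u : V} (hu : ∀ i, f i ≠ u)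
    (hcard : ((cycleVerts f (2 * r)).filter (Gᶜ.Adj u)).card ≤ r) (i : ℤ) :
    G.Adj u (f (i + 1)) ↔ ¬G.Adj u (f i) := by
  constructor
  · intro h h'
    exact hf.not_adj_consecutive (by omega) hG hu rfl h' h
  · intro h
    by_contra h'
    rw [hf.card_filter_cycleVerts (by omega) _ i] at hcard
    have hb : ∀ {j}, ¬G.Adj u (f j) → Gᶜ.Adj u (f j) := fun h =>
      compl_adj_of_not_adj (hu _).symm h
    obtain ⟨s, rfl⟩ : ∃ s, r = s + 1 := ⟨r - 1, by omega⟩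
    rw [show 2 * (s + 1) = 2 + 2 * s by ring, Nat.count_add] at hcard
    have h2 : Nat.count (fun j : ℕ => Gᶜ.Adj u (f (j + i))) 2 = 2 := by
      rw [Nat.count_succ, Nat.count_succ, Nat.count_zero, if_pos, if_pos]
      · simpa [add_comm] using hb h'
      · simpa using hb h
    have h3 := div_two_le_count (P := fun j : ℕ => Gᶜ.Adj u (f ((2 + j : ℕ) + i))) (n := 2 * s)
      fun j _ => by
        by_contra! hcon
        have e1 := adj_of_not_compl_adj (hu _).symm hcon.1
        have e2 := adj_of_not_compl_adj (hu _).symm hcon.2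
        exact hf.not_adj_consecutive (by omega) hG hu (by push_cast; ring) e1 e2
    omega

/-- On a cycle of odd length `2 * k - 1`, a vertex outside with no two consecutive neighbors and at
most `k` non-neighbors is, after a rotation, adjacent to all vertices with odd index below
`2 * k - 1`. -/
theorem exists_shift_adj_odd [DecidableEq V] [DecidableRel Gᶜ.Adj] {k : ℕ} (hk : 2 ≤ k)
    (hf : G.IsCycleFun (2 * k - 1) f) (hG : ¬G.HasCycle (2 * k)) {u : V}
    (hu : ∀ i, f i ≠ u)
    (hcard : ((cycleVerts f (2 * k - 1)).filter (Gᶜ.Adj u)).card ≤ k) :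
    ∃ c : ℤ, ∀ j : ℕ, j + 1 < k → G.Adj u (f (2 * j + 1 + c)) := by
  have hG' : ¬G.HasCycle (2 * k - 1 + 1) := by rwa [show 2 * k - 1 + 1 = 2 * k by omega]
  have hcons : ∀ {i j : ℤ}, j = i + 1 → G.Adj u (f i) → ¬G.Adj u (f j) := fun h =>
    hf.not_adj_consecutive (by omega) hG' hu h
  have hb : ∀ {j}, ¬G.Adj u (f j) → Gᶜ.Adj u (f j) := fun h => compl_adj_of_not_adj (hu _).symm h
  -- Since the length is odd, two consecutive vertices are non-neighbors.
  obtain ⟨c, hc, hc'⟩ : ∃ c, ¬G.Adj u (f (c - 1)) ∧ ¬G.Adj u (f c) := by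
    by_contra! hcon
    have alt : ∀ n : ℕ, G.Adj u (f (2 * n)) ↔ G.Adj u (f 0) := by
      intro n
      induction n with
      | zero => simp
      | succ n ih =>
        rw [← ih]
        push_cast
        constructor
        · intro h
          by_contra h'
          have := hcon (2 * n + 1) (by simpa using h')
          exact hcons (by ring) this h
        · intro h
          have h1 := hcons (j := 2 * n + 1) rfl h
          have := hcon (2 * n + 2) (by rwa [show (2 * n + 2 - 1 : ℤ) = 2 * n + 1 by ring])
          rwa [mul_add, mul_one]
    have h1 := alt k
    have e : f (2 * k) = f 1 := hf.eq_of_dvd ⟨1, by omega⟩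
    rw [e] at h1
    by_cases h0 : G.Adj u (f 0)
    · exact hcons (i := 0) (j := 1) rfl h0 (h1.2 h0)
    · exact h0 (h1.1 (hcon 1 (by simpa using h0)))
  refine ⟨c, fun j hj => ?_⟩
  by_contra hj'
  rw [hf.card_filter_cycleVerts (by omega) _ c] at hcard
  -- Non-neighbors: `f c`, `f (c - 1)`, the vertex in question, and half of the remaining ones.
  obtain ⟨s, rfl⟩ : ∃ s, k = j + s + 2 := ⟨k - j - 2, by omega⟩
  rw [show 2 * (j + s + 2) - 1 = 1 + (2 * j + (1 + (2 * s + 1))) by omega, Nat.count_add,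
    Nat.count_add, Nat.count_add, Nat.count_add] at hcard
  have half : ∀ (a n : ℕ), n / 2 ≤ Nat.count (fun i : ℕ => Gᶜ.Adj u (f ((a + i : ℕ) + c))) n :=
    fun a n => div_two_le_count fun i _ => by
      by_contra! hcon
      have e1 := adj_of_not_compl_adj (hu _).symm hcon.1
      have e2 := adj_of_not_compl_adj (hu _).symm hcon.2
      exact hcons (by push_cast; ring) e1 e2
  have one : ∀ (P : ℕ → Prop) [DecidablePred P], P 0 → Nat.count P 1 = 1 := fun P _ h => by
    rw [Nat.count_succ, Nat.count_zero, if_pos h]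
  have h1 := half 1 (2 * j)
  have h2 := half (1 + 2 * j + 1) (2 * s)
  simp only [add_assoc] at h1 h2 hcard
  rw [one _ (by simpa using hb hc'), one _ (by
      convert hb hj' using 2; push_cast; ring_nf),
    one _ (by
      convert hb hc using 1
      refine hf.eq_of_dvd ⟨1, ?_⟩
      push_cast
      rw [Nat.cast_sub (by omega)]
      push_cast; ring)] at hcard
  omega

end IsCycleFun

/-- A graph with a cycle of length `2 * k - 1` on at least `3 * k - 1` vertices: there is a
monochromatic cycle of length at least `2 * k`. Either the theorem on bipartite graphs gives it in
the complement, between the cycle and `k` vertices outside, or some vertex `u` outside has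
every second vertex of the cycle as a neighbor. Then `u` and the vertices in between form the set
`K` of the configuration above. -/
theorem exists_long_monoCycle_of_odd_cycle [Fintype V] {k : ℕ} (hk : 3 ≤ k)
    (hV : 3 * k - 1 ≤ Fintype.card V) (h : G.HasCycle (2 * k - 1)) :
    ∃ L, 2 * k ≤ L ∧ G.HasMonoCycle L := by
  classical
  by_contra hno
  have hG : ¬G.HasCycle (2 * k) := fun h => hno ⟨_, le_rfl, .inl h⟩
  have hG' : ¬Gᶜ.HasCycle (2 * k) := fun h => hno ⟨_, le_rfl, .inr h⟩
  obtain ⟨-, f, hf⟩ := h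
  obtain ⟨U, hU⟩ : ∃ U, U = Finset.univ \ cycleVerts f (2 * k - 1) := ⟨_, rfl⟩
  have hUcard : k ≤ U.card := by
    rw [hU, Finset.card_sdiff_of_subset (Finset.subset_univ _), hf.card_cycleVerts,
      Finset.card_univ]
    omega
  have hUf : ∀ u ∈ U, ∀ i, f i ≠ u := by
    intro u hu i hi
    rw [hU, Finset.mem_sdiff, hf.mem_cycleVerts (by omega)] at hu
    exact hu.2 ⟨i, hi⟩
  by_cases hdeg : ∀ u ∈ U, k + 1 ≤ ((cycleVerts f (2 * k - 1)).filter (Gᶜ.Adj u)).card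
  · obtain ⟨A, hAU, hA⟩ := Finset.exists_subset_card_eq hUcard
    have hd : Disjoint A (cycleVerts f (2 * k - 1)) := by
      rw [Finset.disjoint_left]
      intro x hx hx'
      obtain ⟨i, hi⟩ := (hf.mem_cycleVerts (by omega)).1 hx'
      exact hUf x (hAU hx) i hi
    exact hG' ((hasCycle_between (G := Gᶜ) (d := k + 1) (by omega) hA hd (by omega)
      (by rw [hf.card_cycleVerts]; omega) fun a ha => hdeg a (hAU ha)).mono between_le)
  push Not at hdeg
  obtain ⟨u, huU, hu⟩ := hdeg
  obtain ⟨c, hc⟩ := hf.exists_shift_adj_odd (by omega) hG (hUf u huU) (by omega)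
  obtain ⟨g, hg, hgU, hgu⟩ : ∃ g, G.IsCycleFun (2 * k - 1) g ∧ (∀ u ∈ U, ∀ i, g i ≠ u) ∧
      ∀ i : ℤ, i % 2 = 1 → 0 ≤ i → i + 2 < 2 * k → G.Adj u (g i) := by
    refine ⟨_, hf.shift c, fun u hu i => hUf u hu _, fun i h1 h2 h3 => ?_⟩
    have := hc (i / 2).toNat (by omega)
    rwa [show (2 * ((i / 2).toNat : ℤ) + 1 + c) = i + c by omega] at this
  have hG1 : ¬G.HasCycle (2 * k - 1 + 1) := by rwa [show 2 * k - 1 + 1 = 2 * k by omega]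
  have hcons : ∀ w ∈ U, ∀ {i j : ℤ}, j = i + 1 → G.Adj w (g i) → ¬G.Adj w (g j) := fun w hw =>
    hg.not_adj_consecutive (by omega) hG1 (hgU w hw)
  have hLk : ((2 * k - 1 : ℕ) : ℤ) = 2 * k - 1 := by omega
  have hinj : ∀ {i j : ℤ}, g i = g j → 0 ≤ i → i + 1 < 2 * k → 0 ≤ j → j + 1 < 2 * k → i = j :=
    fun h _ _ _ _ => hg.inj h (by omega) (by omega)
  obtain ⟨W, hWU, hW⟩ := Finset.exists_subset_card_eq
    (show k - 1 ≤ (U.erase u).card by rw [Finset.card_erase_of_mem huU]; omega)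
  have hWU' : ∀ w ∈ W, w ∈ U := fun w hw => Finset.mem_of_mem_erase (hWU hw)
  have hWu : ∀ w ∈ W, w ≠ u := fun w hw => Finset.ne_of_mem_erase (hWU hw)
  have hLast : g (2 * k - 1) = g 0 := hg.eq_of_dvd ⟨1, by omega⟩
  obtain ⟨K', hK'⟩ : ∃ K', K' = (Finset.range (k - 2)).image fun i : ℕ => g (2 * i + 2) := ⟨_, rfl⟩
  obtain ⟨O, hO⟩ : ∃ O, O = (Finset.range (k - 1)).image fun i : ℕ => g (2 * i + 1) := ⟨_, rfl⟩
  have memK' : ∀ {x}, x ∈ K' → ∃ i : ℤ, 0 < i ∧ i + 2 < 2 * k ∧ i % 2 = 0 ∧ g i = x := by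
    intro x hx
    rw [hK', Finset.mem_image] at hx
    obtain ⟨i, hi, rfl⟩ := hx
    rw [Finset.mem_range] at hi
    exact ⟨2 * i + 2, by omega, by omega, by omega, rfl⟩
  have memO : ∀ {x}, x ∈ O → ∃ i : ℤ, 0 < i ∧ i + 2 < 2 * k ∧ i % 2 = 1 ∧ g i = x := by
    intro x hx
    rw [hO, Finset.mem_image] at hx
    obtain ⟨i, hi, rfl⟩ := hx
    rw [Finset.mem_range] at hi
    exact ⟨2 * i + 1, by omega, by omega, by omega, rfl⟩
  have cardK' : K'.card = k - 2 := by
    rw [hK', Finset.card_image_of_injOn, Finset.card_range]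
    intro i hi j hj hij
    simp only [Finset.coe_range, Set.mem_Iio] at hi hj
    have := hinj hij (by omega) (by omega) (by omega) (by omega)
    omega
  have cardO : O.card = k - 1 := by
    rw [hO, Finset.card_image_of_injOn, Finset.card_range]
    intro i hi j hj hij
    simp only [Finset.coe_range, Set.mem_Iio] at hi hj
    have := hinj hij (by omega) (by omega) (by omega) (by omega)
    omega
  have huK' : u ∉ K' := fun h => by
    obtain ⟨i, -, -, -, hi⟩ := memK' h
    exact hgU u huU i hi
  have hgW : ∀ i, g i ∉ W := fun i h => hgU _ (hWU' _ h) i rfl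
  have blue : ∀ {x y}, x ≠ y → ¬G.Adj x y → Gᶜ.Adj x y := compl_adj_of_not_adj
  refine hno ?_
  have := exists_long_monoCycle_of_configuration (G := Gᶜ) hk (K := insert u K') (O := O) (W := W)
    (p := g 0) (q := g (2 * k - 2)) ?_ cardO hW ?_ ?_ ?_ ?_ ?_ (hgW _) ?_ ?_ (hgW _) ?_ ?_ ?_ ?_ ?_
  · obtain ⟨L, hL, h⟩ := this
    exact ⟨L, hL, hasMonoCycle_compl.1 h⟩
  · rw [Finset.card_insert_of_notMem huK', cardK']; omega
  · rw [Finset.disjoint_left]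
    intro x hx hxO
    obtain ⟨j, hj1, hj2, hj3, rfl⟩ := memO hxO
    rw [Finset.mem_insert] at hx
    rcases hx with hx | hx
    · exact hgU u huU j hx
    · obtain ⟨i, hi1, hi2, hi3, hi⟩ := memK' hx
      have := hinj hi (by omega) (by omega) (by omega) (by omega)
      omega
  · rw [Finset.disjoint_left]
    intro x hx hxW
    rw [Finset.mem_insert] at hx
    rcases hx with hx | hx
    · exact hWu x hxW hx
    · obtain ⟨i, -, -, -, rfl⟩ := memK' hx
      exact hgW i hxW
  · rw [Finset.disjoint_left]
    intro x hx hxW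
    obtain ⟨i, -, -, -, rfl⟩ := memO hx
    exact hgW i hxW
  · rw [Finset.mem_insert, not_or]
    refine ⟨hgU u huU _, fun h => ?_⟩
    obtain ⟨i, hi1, hi2, hi3, hi⟩ := memK' h
    have := hinj hi (by omega) (by omega) (by omega) (by omega)
    omega
  · intro h
    obtain ⟨i, hi1, hi2, hi3, hi⟩ := memO h
    have := hinj hi (by omega) (by omega) (by omega) (by omega)
    omega
  · rw [Finset.mem_insert, not_or]
    refine ⟨hgU u huU _, fun h => ?_⟩
    obtain ⟨i, hi1, hi2, hi3, hi⟩ := memK' h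
    have := hinj hi (by omega) (by omega) (by omega) (by omega)
    omega
  · intro h
    obtain ⟨i, hi1, hi2, hi3, hi⟩ := memO h
    have := hinj hi (by omega) (by omega) (by omega) (by omega)
    omega
  · intro h
    have := hinj h (by omega) (by omega) (by omega) (by omega)
    omega
  · -- A chord from `g 0` into `K'` would give a cycle through `u`.
    intro x hx
    rw [Finset.mem_insert] at hx
    rcases hx with rfl | hx
    · refine blue (hgU _ huU _) fun h => ?_
      exact hcons _ huU (i := 0) (j := 1) rfl h.symm (hgu 1 (by norm_num) (by omega) (by omega))
    · obtain ⟨i, hi1, hi2, hi3, rfl⟩ := memK' hx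
      refine blue (hg.ne (by omega) (by omega) (by omega)) fun h => hG1 ?_
      refine (hg.reflect 0).hasCycle_cross_chord (s := -(i + 1)) (t := -1) (by omega) (by omega)
        (fun i => hgU u huU _) ?_ ?_ ?_
      · simpa using hgu (i + 1) (by omega) (by omega) (by omega)
      · simpa using hgu 1 (by norm_num) (by omega) (by omega)
      · simpa using h.symm
  · intro x hx
    rw [Finset.mem_insert] at hx
    rcases hx with rfl | hx
    · refine blue (hgU _ huU _) fun h => ?_
      exact hcons _ huU (i := 2 * k - 3) (j := 2 * k - 2) (by ring)
        (hgu _ (by omega) (by omega) (by omega)) h.symm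
    · obtain ⟨i, hi1, hi2, hi3, rfl⟩ := memK' hx
      refine blue (hg.ne (by omega) (by omega) (by omega)) fun h => hG1 ?_
      refine hg.hasCycle_cross_chord (s := i - 1) (t := 2 * k - 3) (by omega) (by omega)
        (hgU u huU) (hgu _ (by omega) (by omega) (by omega))
        (hgu _ (by omega) (by omega) (by omega)) ?_
      rw [show i - 1 + 1 = i by ring, show (2 * k - 3 + 1 : ℤ) = 2 * k - 2 by ring]
      exact h.symm
  · -- A vertex of `W` adjacent to `K` and to `O` would give a cycle through it and `u`.
    intro w hw
    have hwU := hWU' w hw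
    by_contra! hcon
    obtain ⟨⟨x, hx, hwx⟩, y, hy, hwy⟩ := hcon
    obtain ⟨o, ho1, ho2, ho3, rfl⟩ := memO hy
    have hwo := adj_of_not_compl_adj (hgU w hwU _).symm hwy
    rw [Finset.mem_insert] at hx
    rcases hx with rfl | hx
    · have hwu := adj_of_not_compl_adj (hWu w hw) hwx
      have hmem : ∀ i, g i ≠ x ∧ g i ≠ w := fun i => ⟨hgU _ huU i, hgU w hwU i⟩
      by_cases ho : o + 4 < 2 * k
      · refine hG (hg.hasCycle_bridge (a := o) (b := o + 2) (d := 2) rfl (by norm_num) (by omega)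
          (.pair hwu) ?_ hwo.symm (hgu _ (by omega) (by omega) (by omega)) (by simp; omega)
          (by omega))
        intro i; simp [hmem i]
      · refine hG (hg.hasCycle_bridge (a := o - 2) (b := o) (d := 2) (by simp) (by norm_num)
          (by omega) (.pair hwu.symm) ?_ (hgu _ (by omega) (by omega) (by omega)).symm hwo
          (by simp; omega) (by omega))
        intro i; simp [hmem i]
    · obtain ⟨e, he1, he2, he3, rfl⟩ := memK' hx
      have hwe := adj_of_not_compl_adj (hgU w hwU _).symm hwx
      rcases lt_trichotomy o (e - 1) with h | h | h
      · refine hG1 ((hg.reflect 0).hasCycle_detour (e := -e) (o := -o) (u := u) (w := w) (by omega)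
          (by omega) (fun i => hgU u huU _) (fun i => hgU w hwU _) (hWu w hw).symm ?_ ?_ ?_ ?_)
        · convert hgu (o + 2) (by omega) (by omega) (by omega) using 2; ring
        · convert hgu (e + 1) (by omega) (by omega) (by omega) using 2; ring
        · simpa using hwe
        · simpa using hwo
      · exact hcons w hwU (by omega) hwo hwe
      · by_cases h' : o = e + 1
        · exact hcons w hwU h' hwe hwo
        · exact hG1 (hg.hasCycle_detour (e := e) (o := o) (u := u) (w := w) (by omega) (by omega)
            (hgU u huU) (hgU w hwU) (hWu w hw).symm (hgu _ (by omega) (by omega) (by omega))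
            (hgu _ (by omega) (by omega) (by omega)) hwe hwo)
  · intro w hw
    have hwU := hWU' w hw
    by_contra! hcon
    have h1 := adj_of_not_compl_adj (hgU w hwU _).symm hcon.1
    have h2 := adj_of_not_compl_adj (hgU w hwU _).symm hcon.2
    rw [← hLast] at h1
    exact hcons w hwU (by ring) h2 h1

/-- A graph with a cycle of length `2 * k - 2` on at least `3 * k - 1` vertices: there is a
monochromatic cycle of length at least `2 * k - 1`. Either the theorem on bipartite graphs gives it
in the complement, or two vertices `u`, `v` outside have every second vertex of the cycle as
a neighbor. These are the same vertices for both, and `u`, `v` are the two special vertices of the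
configuration above. -/
theorem exists_long_monoCycle_of_even_cycle [Fintype V] {k : ℕ} (hk : 3 ≤ k)
    (hV : 3 * k - 1 ≤ Fintype.card V) (h : G.HasCycle (2 * k - 2)) :
    ∃ L, 2 * k - 1 ≤ L ∧ G.HasMonoCycle L := by
  classical
  by_contra hno
  obtain ⟨r, rfl⟩ : ∃ r, k = r + 1 := ⟨k - 1, by omega⟩
  rw [show 2 * (r + 1) - 2 = 2 * r by omega] at h
  rw [show 2 * (r + 1) - 1 = 2 * r + 1 by omega] at hno
  have hG1 : ¬G.HasCycle (2 * r + 1) := fun h => hno ⟨_, le_rfl, .inl h⟩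
  have hG2 : ¬G.HasCycle (2 * r + 2) := fun h => hno ⟨_, by omega, .inl h⟩
  have hG' : ¬Gᶜ.HasCycle (2 * (r + 1)) := fun h => hno ⟨_, by omega, .inr h⟩
  obtain ⟨-, f, hf⟩ := h
  obtain ⟨U, hU⟩ : ∃ U, U = Finset.univ \ cycleVerts f (2 * r) := ⟨_, rfl⟩
  have hUcard : r + 2 ≤ U.card := by
    rw [hU, Finset.card_sdiff_of_subset (Finset.subset_univ _), hf.card_cycleVerts,
      Finset.card_univ]
    omega
  have hUf : ∀ u ∈ U, ∀ i, f i ≠ u := by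
    intro u hu i hi
    rw [hU, Finset.mem_sdiff, hf.mem_cycleVerts (by omega)] at hu
    exact hu.2 ⟨i, hi⟩
  obtain ⟨A, hA⟩ : ∃ A, A = U.filter fun u =>
    r + 1 ≤ ((cycleVerts f (2 * r)).filter (Gᶜ.Adj u)).card := ⟨_, rfl⟩
  have hAU : A ⊆ U := hA ▸ Finset.filter_subset _ _
  by_cases hAcard : r + 1 ≤ A.card
  · obtain ⟨A', hA'A, hA'⟩ := Finset.exists_subset_card_eq hAcard
    have hd : Disjoint A' (cycleVerts f (2 * r)) := by
      rw [Finset.disjoint_left]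
      intro x hx hx'
      obtain ⟨i, hi⟩ := (hf.mem_cycleVerts (by omega)).1 hx'
      exact hUf x (hAU (hA'A hx)) i hi
    refine hG' ((hasCycle_between (G := Gᶜ) (d := r + 1) (by omega) hA' hd (by omega)
      (by rw [hf.card_cycleVerts]; omega) fun a ha => ?_).mono between_le)
    have := hA'A ha
    rw [hA, Finset.mem_filter] at this
    exact this.2
  obtain ⟨u, hu, v, hv, huv⟩ := Finset.one_lt_card.1
    (show 1 < (U \ A).card by rw [Finset.card_sdiff_of_subset hAU]; omega)
  have alt : ∀ u ∈ U \ A, ∀ i, G.Adj u (f (i + 1)) ↔ ¬G.Adj u (f i) := by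
    intro u hu
    rw [Finset.mem_sdiff, hA, Finset.mem_filter] at hu
    exact hf.adj_succ_iff_of_card_le (by omega) hG1 (hUf u hu.1)
      (by by_contra hh; exact hu.2 ⟨hu.1, by omega⟩)
  -- Rotate the cycle so that `u` is adjacent to the vertices with odd index.
  obtain ⟨g, hg, hgU, hgalt, hgu⟩ : ∃ g, G.IsCycleFun (2 * r) g ∧ (∀ u ∈ U, ∀ i, g i ≠ u) ∧
      (∀ u ∈ U \ A, ∀ i, G.Adj u (g (i + 1)) ↔ ¬G.Adj u (g i)) ∧ ¬G.Adj u (g 0) := by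
    by_cases h0 : G.Adj u (f 0)
    · refine ⟨_, hf.shift 1, fun u hu i => hUf u hu _, fun u hu i => alt u hu (i + 1), ?_⟩
      exact fun h => (alt u hu 0).1 h h0
    · exact ⟨f, hf, hUf, alt, h0⟩
  have even : ∀ u ∈ U \ A, ¬G.Adj u (g 0) → ∀ i : ℤ, ¬G.Adj u (g (2 * i)) := by
    intro u hu h0 i
    have step : ∀ i : ℤ, G.Adj u (g (i + 2)) ↔ G.Adj u (g i) := fun i => by
      rw [show i + 2 = i + 1 + 1 by ring, hgalt u hu, hgalt u hu, not_not]
    induction i using Int.induction_on with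
    | zero => simpa using h0
    | succ i hi => rwa [mul_add, mul_one, step]
    | pred i hi => rwa [← step, show (2 * (-(i : ℤ) - 1) + 2) = 2 * -i by ring]
  have odd : ∀ u ∈ U \ A, ¬G.Adj u (g 0) → ∀ i : ℤ, i % 2 = 1 → G.Adj u (g i) := by
    intro u hu h0 i hi
    obtain ⟨j, rfl⟩ : ∃ j, i = 2 * j + 1 := ⟨i / 2, by omega⟩
    exact (hgalt u hu _).2 (even u hu h0 j)
  have huU := (Finset.mem_sdiff.1 hu).1
  have hvU := (Finset.mem_sdiff.1 hv).1
  have hgv : ¬G.Adj v (g 0) := by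
    intro h
    have hv2 : ∀ j : ℤ, G.Adj v (g (2 * j)) := by
      intro j
      have step : ∀ i : ℤ, G.Adj v (g (i + 2)) ↔ G.Adj v (g i) := fun i => by
        rw [show i + 2 = i + 1 + 1 by ring, hgalt v hv, hgalt v hv, not_not]
      induction j using Int.induction_on with
      | zero => simpa using h
      | succ i hi => rwa [mul_add, mul_one, step]
      | pred i hi => rwa [← step, show (2 * (-(i : ℤ) - 1) + 2) = 2 * -i by ring]
    -- The cycle `g 0, g 1, u, g 3, g 2, v, g 4, …` contains `u` and `v`.
    have p1 := hg.isPathList_ascend (a := 4) (b := 2 * r + 1) (n := 2 * r - 2) (by omega) (by omega)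
      (by omega)
    have p2 := hg.isPathList_descend (a := 3) (b := 2) (n := 2) (by norm_num) (by omega)
      (by norm_num)
    have p3 := (p1.concat (odd u hu hgu _ (by omega)).symm (by
        rw [mem_ascend]; rintro ⟨i, -, -, hi⟩; exact hgU u huU i hi)).append p2
      (odd u hu hgu 3 (by norm_num)) (by
      intro x hx hx'
      obtain ⟨j, hj1, hj2, rfl⟩ := mem_descend.1 hx'
      rw [List.mem_append, mem_ascend] at hx
      rcases hx with ⟨i, hi1, hi2, hi3⟩ | hx
      · have := hg.inj hi3 (by omega) (by omega)
        omega
      · exact hgU u huU j (by simpa using hx))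
    have p4 := (p3.concat (hv2 1).symm (c := v) (by
      simp only [List.mem_append, mem_ascend, mem_descend, List.mem_singleton]
      rintro ((⟨i, -, -, hi⟩ | hi) | ⟨i, -, -, hi⟩)
      · exact hgU v hvU i hi
      · exact huv hi.symm
      · exact hgU v hvU i hi)).hasCycle (hv2 2) (by simp)
    refine hG2 ?_
    convert p4 using 1
    simp; omega
  obtain ⟨W, hWU, hW⟩ := Finset.exists_subset_card_eq
    (show r ≤ ((U.erase u).erase v).card by
      rw [Finset.card_erase_of_mem (by simp [huv.symm, hvU]), Finset.card_erase_of_mem huU]; omega)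
  have hWmem : ∀ w ∈ W, w ≠ v ∧ w ≠ u ∧ w ∈ U := fun w hw => by
    have := hWU hw
    rwa [Finset.mem_erase, Finset.mem_erase] at this
  have hr1 : 1 ≤ r := by omega
  have hgC : ∀ c, ∀ w ∈ U, w ∉ alternateVerts g r c := fun c w hw h => by
    obtain ⟨i, hi⟩ := (hg.mem_alternateVerts hr1).1 h
    exact hgU w hw _ hi
  have hdW : ∀ c, Disjoint (alternateVerts g r c) W := fun c =>
    Finset.disjoint_left.2 fun x hx hxW => hgC c x (hWmem x hxW).2.2 hx
  have hcons : ∀ w ∈ U, ∀ {i j : ℤ}, j = i + 1 → G.Adj w (g i) → ¬G.Adj w (g j) := fun w hw =>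
    hg.not_adj_consecutive (by omega) hG1 (hgU w hw)
  have blueEven : ∀ u ∈ U \ A, ¬G.Adj u (g 0) → ∀ x ∈ alternateVerts g r 0, Gᶜ.Adj u x := by
    intro u hu h0 x hx
    obtain ⟨i, rfl⟩ := (hg.mem_alternateVerts hr1).1 hx
    rw [zero_add]
    exact compl_adj_of_not_adj (hgU u (Finset.mem_sdiff.1 hu).1 _).symm (even u hu h0 i)
  obtain ⟨L, hL, h⟩ := exists_long_monoCycle_of_configuration (G := Gᶜ) hk
    (K := alternateVerts g r 0) (O := alternateVerts g r 1) (W := W) (p := u) (q := v)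
    (hg.card_alternateVerts 0) (hg.card_alternateVerts 1) hW
    (hg.disjoint_alternateVerts (by norm_num)) (hdW 0) (hdW 1) (hgC 0 u huU) (hgC 1 u huU)
    (fun h => (hWmem u h).2.1 rfl) (hgC 0 v hvU) (hgC 1 v hvU) (fun h => (hWmem v h).1 rfl) huv
    (blueEven u hu hgu) (blueEven v hv hgv) (by
      intro w hw
      obtain ⟨-, hwu, hwU⟩ := hWmem w hw
      by_contra! hcon
      obtain ⟨⟨x, hx, hwx⟩, y, hy, hwy⟩ := hcon
      obtain ⟨i, rfl⟩ := (hg.mem_alternateVerts hr1).1 hx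
      obtain ⟨j, rfl⟩ := (hg.mem_alternateVerts hr1).1 hy
      have hwe := adj_of_not_compl_adj (hgU w hwU _).symm hwx
      have hwo := adj_of_not_compl_adj (hgU w hwU _).symm hwy
      -- Choose the index `0 + 2 * i + d` of the second neighbor within one period.
      obtain ⟨d, hd1, hd2, hd3, hd4⟩ : ∃ d : ℤ, 0 ≤ d ∧ d < 2 * r ∧ d % 2 = 1 ∧
          g (0 + 2 * i + d) = g (1 + 2 * j) := by
        have e := Int.mul_ediv_add_emod (1 + 2 * j - 2 * i) (2 * r)
        refine ⟨(1 + 2 * j - 2 * i) % (2 * r), Int.emod_nonneg _ (by omega),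
          Int.emod_lt_of_pos _ (by omega), ?_, hg.eq_of_dvd
            ⟨-((1 + 2 * j - 2 * i) / (2 * r)), by push_cast; linear_combination e⟩⟩
        rw [mul_assoc] at e
        omega
      rw [← hd4] at hwo
      by_cases hd : d = 1
      · subst hd
        exact hcons w hwU rfl hwe hwo
      · exact hG1 (hg.hasCycle_detour (u := u) (w := w) (by omega) (by push_cast; omega)
          (hgU u huU) (hgU w hwU) hwu.symm (odd u hu hgu _ (by omega)) (odd u hu hgu _ (by omega))
          hwe hwo)) (by
      intro w hw
      obtain ⟨hwv, hwu, hwU⟩ := hWmem w hw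
      by_contra! hcon
      have h1 := adj_of_not_compl_adj hwu hcon.1
      have h2 := adj_of_not_compl_adj hwv hcon.2
      refine hG2 (hg.hasCycle_bridge (a := 1) (b := 3) (d := 2) (by norm_num) (by norm_num)
        (by omega) (((IsPathList.singleton v).cons h2 (by simpa using hwv)).cons h1.symm
          (by simp [huv, hwu.symm])) ?_ (odd u hu hgu 1 (by norm_num)).symm
        (odd v hv hgv 3 (by norm_num)) (by simp) (by omega))
      intro i
      simp [hgU u huU i, hgU v hvU i, hgU w hwU i])
  exact hno ⟨L, by omega, hasMonoCycle_compl.1 h⟩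

/-- Four neighbors of `v` in one color: either another vertex shares two of them with `v` in that
color, or two further vertices have two common neighbors among them in the other color. -/
theorem hasMonoCycle_four [Fintype V] (hV : 8 ≤ Fintype.card V) : G.HasMonoCycle 4 := by
  classical
  obtain ⟨v⟩ : Nonempty V := Fintype.card_pos_iff.1 (by omega)
  have key : ∀ (H : SimpleGraph V) (N : Finset V), (∀ x ∈ N, H.Adj v x) → 3 < N.card →
      H.HasMonoCycle 4 := by
    intro H N hN hH
    obtain ⟨S, hSN, hS⟩ := Finset.exists_subset_card_eq (show 4 ≤ _ from hH)
    have hSv : ∀ x ∈ S, H.Adj v x := fun x hx => hN x (hSN hx)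
    have hvS : v ∉ S := fun h => H.loopless.irrefl v (hSv v h)
    have hcard : 2 ≤ (Finset.univ \ insert v S).card := by
      rw [Finset.card_sdiff_of_subset (Finset.subset_univ _), Finset.card_univ,
        Finset.card_insert_of_notMem hvS]
      omega
    obtain ⟨A, hAs, hA⟩ := Finset.exists_subset_card_eq hcard
    have hAmem : ∀ a ∈ A, a ≠ v ∧ a ∉ S := fun a ha => by simpa using hAs ha
    by_contra hno
    rw [HasMonoCycle, not_or] at hno
    refine hno.2 ((hasCycle_between (G := Hᶜ) (n := 2) (B := S) (d := 3) le_rfl hA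
      (Finset.disjoint_left.2 fun a ha => (hAmem a ha).2) (by norm_num) (by omega)
      fun a ha => ?_).mono between_le)
    by_contra hlt
    have h1 := Finset.card_filter_add_card_filter_not (s := S) (Hᶜ.Adj a)
    refine hno.1 (hasCycle_bipartite (n := 2) (A := {v, a}) (B := S.filter fun x => ¬Hᶜ.Adj a x)
      le_rfl ?_ ?_ (Finset.card_pair (hAmem a ha).1.symm).ge (by omega))
    · rw [Finset.disjoint_left]
      intro x hx hx'
      have hxS := (Finset.mem_filter.1 hx').1
      simp only [Finset.mem_insert, Finset.mem_singleton] at hx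
      rcases hx with rfl | rfl
      · exact hvS hxS
      · exact (hAmem x ha).2 hxS
    · intro x hx y hy
      rw [Finset.mem_filter] at hy
      simp only [Finset.mem_insert, Finset.mem_singleton] at hx
      rcases hx with rfl | rfl
      · exact hSv y hy.1
      · exact adj_of_not_compl_adj (by rintro rfl; exact (hAmem x ha).2 hy.1) hy.2
  by_cases h : 3 < (Finset.univ.filter (G.Adj v)).card
  · exact key G _ (fun x hx => (Finset.mem_filter.1 hx).2) h
  · refine hasMonoCycle_compl.1 (key Gᶜ ((Finset.univ.filter fun x => ¬G.Adj v x).erase v) ?_ ?_)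
    · intro x hx
      rw [Finset.mem_erase, Finset.mem_filter] at hx
      exact compl_adj_of_not_adj (Ne.symm hx.1) hx.2.2
    · have h1 := Finset.card_filter_add_card_filter_not (s := Finset.univ) (G.Adj v)
      rw [Finset.card_univ] at h1
      rw [Finset.card_erase_of_mem (by simp)]
      omega

/-- Every 2-coloring of a complete graph on at least `3 * k - 1` vertices has a monochromatic cycle
of length at least `2 * k`. A cycle for `k - 1`, of length at least `2 * k - 2`, is lengthened at
most twice. -/
theorem exists_long_monoCycle [Fintype V] {k : ℕ} (hk : 3 ≤ k)
    (hV : 3 * k - 1 ≤ Fintype.card V) : ∃ L, 2 * k ≤ L ∧ G.HasMonoCycle L := by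
  have extend : ∀ {k : ℕ}, 3 ≤ k → 3 * k - 1 ≤ Fintype.card V →
      (∃ L, 2 * k - 2 ≤ L ∧ G.HasMonoCycle L) → ∃ L, 2 * k ≤ L ∧ G.HasMonoCycle L := by
    intro k hk hV h
    have odd : (∃ L, 2 * k - 1 ≤ L ∧ G.HasMonoCycle L) → ∃ L, 2 * k ≤ L ∧ G.HasMonoCycle L := by
      rintro ⟨L, hL, h⟩
      by_cases hL' : L = 2 * k - 1
      · subst hL'
        refine h.elim_of_symm (P := fun G => ∃ L, 2 * k ≤ L ∧ G.HasMonoCycle L)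
          (fun H h => exists_long_monoCycle_of_odd_cycle hk hV h) ?_
        rintro ⟨L, hL, h⟩
        exact ⟨L, hL, hasMonoCycle_compl.1 h⟩
      · exact ⟨L, by omega, h⟩
    obtain ⟨L, hL, h⟩ := h
    by_cases hL' : L = 2 * k - 2
    · subst hL'
      refine odd (h.elim_of_symm (P := fun G => ∃ L, 2 * k - 1 ≤ L ∧ G.HasMonoCycle L)
        (fun H h => exists_long_monoCycle_of_even_cycle hk hV h) ?_)
      rintro ⟨L, hL, h⟩
      exact ⟨L, hL, hasMonoCycle_compl.1 h⟩
    · exact odd ⟨L, by omega, h⟩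
  induction k, hk using Nat.le_induction with
  | base => exact extend le_rfl hV ⟨4, le_rfl, hasMonoCycle_four (by omega)⟩
  | succ k hk ih =>
    obtain ⟨L, hL, h⟩ := ih (by omega)
    exact extend (by omega) hV ⟨L, by omega, h⟩

/-! ### Ramsey numbers of cycles -/

/-- The Ramsey number of the even cycle of length `2 * k ≥ 6` is at most `3 * k - 1`. -/
theorem hasMonoCycle_even [Fintype V] {k : ℕ} (hk : 3 ≤ k) (hV : 3 * k - 1 ≤ Fintype.card V) :
    G.HasMonoCycle (2 * k) := by
  obtain ⟨L, hL, h⟩ := exists_long_monoCycle (G := G) hk hV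
  exact h.to_even hk hL

/-- The Ramsey number of the odd cycle of length `2 * r - 1 ≥ 7` is at most `4 * r - 3`. -/
theorem hasMonoCycle_odd [Fintype V] {r : ℕ} (hr : 4 ≤ r) (hV : 4 * r - 3 ≤ Fintype.card V) :
    G.HasMonoCycle (2 * r - 1) :=
  (hasMonoCycle_even (by omega) (by omega)).sub_one_of_even hr hV

/-! ### Cycles of every length in graphs of large minimum degree -/

theorem IsPathList.split {l : List V} {a b : V} (h : G.IsPathList l a b) {i : ℕ}
    (hi : i + 1 < l.length) :
    G.IsPathList (l.take (i + 1)) a l[i] ∧ G.IsPathList (l.drop (i + 1)) l[i + 1] b := by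
  obtain ⟨h1, h2, h3, h4⟩ := h
  have e := List.take_append_drop (i + 1) l
  refine ⟨⟨h1.take _, h2.sublist (List.take_sublist _ _), ?_, ?_⟩,
    ⟨h1.drop _, h2.sublist (List.drop_sublist _ _), ?_, ?_⟩⟩
  · rw [List.head?_take]; simpa using h3
  · rw [List.getLast?_take]; simp [show i < l.length by omega]
  · rw [List.head?_drop]; simp
  · rw [List.getLast?_drop, if_neg (by omega), h4]

theorem IsPathList.length_le_card [Fintype V] {l : List V} {a b : V} (h : G.IsPathList l a b) :
    l.length ≤ Fintype.card V :=
  h.2.1.length_le_card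

theorem exists_longest_isPathList [Fintype V] [Nonempty V] (G : SimpleGraph V) :
    ∃ l a b, G.IsPathList l a b ∧ ∀ l' a' b', G.IsPathList l' a' b' → l'.length ≤ l.length := by
  have hne : {n | ∃ l a b, G.IsPathList l a b ∧ l.length = n}.Nonempty :=
    ⟨1, [Classical.arbitrary V], _, _, .singleton _, rfl⟩
  have hbdd : BddAbove {n | ∃ l a b, G.IsPathList l a b ∧ l.length = n} :=
    ⟨Fintype.card V, by rintro n ⟨l, a, b, h, rfl⟩; exact h.length_le_card⟩
  obtain ⟨l, a, b, h, hlen⟩ := Nat.sSup_mem hne hbdd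
  exact ⟨l, a, b, h, fun l' a' b' h' => hlen ▸ le_csSup hbdd ⟨l', a', b', h', rfl⟩⟩

/-- Dirac's theorem, for minimum degree larger than half the number of vertices. The vertices of a
longest path also form a cycle, and a vertex off this cycle with a neighbor on it would give a
longer path. -/
theorem hasCycle_card_of_degree [Fintype V] [DecidableRel G.Adj] (hV : 3 ≤ Fintype.card V)
    (hdeg : ∀ v, Fintype.card V < 2 * G.degree v) : G.HasCycle (Fintype.card V) := by
  classical
  have : Nonempty V := Fintype.card_pos_iff.1 (by omega)
  obtain ⟨l, a, b, hl, hmax⟩ := exists_longest_isPathList G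
  have hnb : ∀ {c d}, G.IsPathList l c d → ∀ x, G.Adj c x → x ∈ l := by
    intro c d h x hx
    by_contra hxl
    have := hmax _ _ _ (h.cons hx.symm hxl)
    simp at this
  have hdl : ∀ {c d}, G.IsPathList l c d → G.degree c + 1 ≤ l.length := by
    intro c d h
    rw [← List.toFinset_card_of_nodup h.2.1, ← G.card_neighborFinset_eq_degree,
      ← Finset.card_insert_of_notMem (G.notMem_neighborFinset_self c)]
    refine Finset.card_le_card fun x hx => ?_
    rw [Finset.mem_insert, mem_neighborFinset] at hx
    rw [List.mem_toFinset]
    rcases hx with rfl | hx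
    · exact h.head_mem
    · exact hnb h x hx
  have hda := hdl hl
  have hdega := hdeg a
  have hlV := hl.length_le_card
  -- Two consecutive vertices `l[i]`, `l[i + 1]` with `l[i + 1]` adjacent to `a`, `l[i]` to `b`.
  obtain ⟨i, hi, hia, hib⟩ : ∃ i, ∃ hi : i + 1 < l.length, G.Adj a l[i + 1] ∧ G.Adj b l[i] := by
    by_contra! hcon
    let P : ℕ → Prop := fun i => ∃ h : i + 1 < l.length, G.Adj a l[i + 1]
    let Q : ℕ → Prop := fun i => ∃ h : i + 1 < l.length, G.Adj b l[i]
    have hdis : Disjoint ((Finset.range (l.length - 1)).filter P)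
        ((Finset.range (l.length - 1)).filter Q) := by
      rw [Finset.disjoint_left]
      intro i hi hi'
      obtain ⟨h, h'⟩ := (Finset.mem_filter.1 hi).2
      exact hcon i h h' (Finset.mem_filter.1 hi').2.2
    have hsum := Finset.card_le_card (Finset.union_subset
      (Finset.filter_subset P (Finset.range (l.length - 1)))
      (Finset.filter_subset Q (Finset.range (l.length - 1))))
    rw [Finset.card_union_of_disjoint hdis, Finset.card_range] at hsum
    have h1 : G.degree a ≤ ((Finset.range (l.length - 1)).filter P).card := by
      rw [← G.card_neighborFinset_eq_degree]
      refine Finset.card_le_card_of_surjOn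
        (fun i => if h : i + 1 < l.length then l[i + 1] else a) ?_
      intro x hx
      rw [Finset.mem_coe, mem_neighborFinset] at hx
      obtain ⟨j, hj, rfl⟩ := List.getElem_of_mem (hnb hl x hx)
      have hj0 : j ≠ 0 := by
        rintro rfl
        have h3 := hl.2.2.1
        rw [List.head?_eq_getElem?, List.getElem?_eq_some_iff] at h3
        obtain ⟨_, h3⟩ := h3
        exact hx.ne h3.symm
      obtain ⟨i, rfl⟩ : ∃ i, j = i + 1 := ⟨j - 1, by omega⟩
      exact ⟨i, by simpa [P, hj] using ⟨by omega, hx⟩, by simp [hj]⟩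
    have h2 : G.degree b ≤ ((Finset.range (l.length - 1)).filter Q).card := by
      rw [← G.card_neighborFinset_eq_degree]
      refine Finset.card_le_card_of_surjOn (fun i => if h : i < l.length then l[i] else a) ?_
      intro x hx
      rw [Finset.mem_coe, mem_neighborFinset] at hx
      obtain ⟨j, hj, rfl⟩ : ∃ j, ∃ h : j < l.length, l[j] = x := by
        refine List.getElem_of_mem ?_
        by_contra hxl
        have := hmax _ _ _ (hl.concat hx hxl)
        simp at this
      have hj0 : j + 1 ≠ l.length := by
        intro hjl
        have h4 := hl.2.2.2
        rw [List.getLast?_eq_getElem?, List.getElem?_eq_some_iff] at h4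
        obtain ⟨_, h4⟩ := h4
        simp only [← hjl, Nat.add_sub_cancel] at h4
        exact hx.ne h4.symm
      have hj1 : j + 1 < l.length := by omega
      exact ⟨j, by simpa [Q, hj1] using ⟨by omega, hx⟩, by simp [hj]⟩
    have := hdeg b
    omega
  obtain ⟨p1, p2⟩ := hl.split hi
  have hperm : ∀ x, x ∈ (l.take (i + 1)).reverse ++ l.drop (i + 1) ↔ x ∈ l := by
    intro x
    rw [List.mem_append, List.mem_reverse, ← List.mem_append, List.take_append_drop]
  have hnd := hl.2.1
  rw [← List.take_append_drop (i + 1) l, List.nodup_append] at hnd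
  have p := p1.reverse.append p2 hia fun x hx hx' => hnd.2.2 x (List.mem_reverse.1 hx) x hx' rfl
  have hlen : ((l.take (i + 1)).reverse ++ l.drop (i + 1)).length = l.length := by
    simp; omega
  by_cases hs : l.length = Fintype.card V
  · rw [← hs, ← hlen]
    exact p.hasCycle hib (by omega)
  · exfalso
    obtain ⟨f, hf, hfl⟩ := p.isCycleFun hib
    rw [hlen] at hf
    have hsub : cycleVerts f l.length = l.toFinset := by
      refine Finset.eq_of_subset_of_card_le (fun x hx => ?_) ?_
      · obtain ⟨i, rfl⟩ := (hf.mem_cycleVerts (by omega)).1 hx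
        rw [List.mem_toFinset]
        exact (hperm _).1 (hfl i)
      · rw [hf.card_cycleVerts, List.toFinset_card_of_nodup hl.2.1]
    obtain ⟨x, hx⟩ : (Finset.univ \ l.toFinset).Nonempty := by
      rw [← Finset.card_pos, Finset.card_sdiff_of_subset (Finset.subset_univ _), Finset.card_univ,
        List.toFinset_card_of_nodup hl.2.1]
      omega
    have hxl : x ∉ l := by simpa using hx
    -- The vertices off `l` are too few to contain all neighbors of `x`.
    obtain ⟨y, hy, hxy⟩ : ∃ y ∈ l, G.Adj x y := by
      by_contra! hcon
      have h1 : insert x (G.neighborFinset x) ⊆ Finset.univ \ l.toFinset := by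
        intro z hz
        rw [Finset.mem_insert, mem_neighborFinset] at hz
        rcases hz with rfl | hz
        · exact hx
        · rw [Finset.mem_sdiff, List.mem_toFinset]
          exact ⟨Finset.mem_univ _, fun h => hcon z h hz⟩
      have h2 := Finset.card_le_card h1
      rw [Finset.card_insert_of_notMem (G.notMem_neighborFinset_self x),
        G.card_neighborFinset_eq_degree, Finset.card_sdiff_of_subset (Finset.subset_univ _),
        Finset.card_univ, List.toFinset_card_of_nodup hl.2.1] at h2
      have := hdeg x
      omega
    obtain ⟨c, rfl⟩ := (hf.mem_cycleVerts (by omega)).1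
      (show y ∈ cycleVerts f l.length by rw [hsub, List.mem_toFinset]; exact hy)
    have q := (hf.isPathList_ascend (a := c) (b := c + l.length - 1) (n := l.length) (by omega)
      le_rfl rfl).cons hxy (by
        rw [mem_ascend]
        rintro ⟨i, -, -, rfl⟩
        exact hxl ((hperm _).1 (hfl i)))
    have := hmax _ _ _ q
    simp at this

/-- Bondy's theorem on pancyclic graphs: minimum degree larger than half the number of vertices
forces cycles of all lengths. In a Hamiltonian cycle `f` without chords closing a cycle of
length `m`, a neighbor `f j` of `f 0` excludes a neighbor of `f (-1)`, whose index is `j` plus a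
constant, cyclically. -/
theorem hasCycle_of_degree [Fintype V] [DecidableRel G.Adj] {m : ℕ} (hm : 3 ≤ m)
    (hmV : m ≤ Fintype.card V) (hdeg : ∀ v, Fintype.card V < 2 * G.degree v) : G.HasCycle m := by
  classical
  have hcyc := hasCycle_card_of_degree (by omega) hdeg
  by_contra hno
  obtain ⟨L, hL⟩ : ∃ L, L = Fintype.card V := ⟨_, rfl⟩
  rw [← hL] at hmV hcyc hdeg
  have hmL : m < L := lt_of_le_of_ne hmV (by rintro rfl; exact hno hcyc)
  obtain ⟨-, f, hf⟩ := hcyc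
  have huniv : cycleVerts f L = Finset.univ :=
    Finset.eq_univ_of_card _ (by rw [hf.card_cycleVerts, hL])
  have hlast : f (-1) = f (L - 1) := hf.eq_of_dvd ⟨-1, by ring⟩
  have hclose : G.Adj (f (L - 1)) (f 0) := by rw [← hlast]; exact hf.adj (by norm_num)
  let A := (Finset.Icc 1 (L - 2)).filter fun j : ℕ => G.Adj (f 0) (f j)
  let B := (Finset.Icc 1 (L - 2)).filter fun j : ℕ => G.Adj (f (L - 1)) (f j)
  have index : ∀ x, ∃ j : ℕ, j < L ∧ f j = x := fun x => by
    have hx : x ∈ cycleVerts f L := huniv ▸ Finset.mem_univ x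
    simpa [cycleVerts] using hx
  have hA : G.degree (f 0) ≤ A.card + 1 := by
    have hsub : G.neighborFinset (f 0) ⊆ (insert (L - 1) A).image fun j : ℕ => f j := by
      intro x hx
      rw [mem_neighborFinset] at hx
      obtain ⟨j, hj, rfl⟩ := index x
      refine Finset.mem_image.2 ⟨j, ?_, rfl⟩
      have hj0 : j ≠ 0 := by rintro rfl; exact hx.ne (by simp)
      by_cases hjL : j = L - 1
      · simp [hjL]
      · exact Finset.mem_insert_of_mem (Finset.mem_filter.2
          ⟨Finset.mem_Icc.2 ⟨by omega, by omega⟩, hx⟩)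
    rw [← G.card_neighborFinset_eq_degree]
    exact (Finset.card_le_card hsub).trans
      (Finset.card_image_le.trans (Finset.card_insert_le _ _))
  have hB : G.degree (f (L - 1)) ≤ B.card + 1 := by
    have hsub : G.neighborFinset (f (L - 1)) ⊆ (insert 0 B).image fun j : ℕ => f j := by
      intro x hx
      rw [mem_neighborFinset] at hx
      obtain ⟨j, hj, rfl⟩ := index x
      refine Finset.mem_image.2 ⟨j, ?_, rfl⟩
      have hjL : j ≠ L - 1 := by
        rintro rfl
        exact hx.ne (by congr 1; omega)
      by_cases hj0 : j = 0
      · simp [hj0]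
      · exact Finset.mem_insert_of_mem (Finset.mem_filter.2
          ⟨Finset.mem_Icc.2 ⟨by omega, by omega⟩, hx⟩)
    rw [← G.card_neighborFinset_eq_degree]
    exact (Finset.card_le_card hsub).trans
      (Finset.card_image_le.trans (Finset.card_insert_le _ _))
  have hAB : A.card + B.card ≤ L - 2 := by
    -- With `j` in `A` and `φ j` in `B`, the vertices `f 0`, `f (L - 1)` close a cycle of length `m`
    -- with the arc from `f j` to `f (φ j)`, or with the two arcs left by the indices between `φ j`
    -- and `j`.
    let φ : ℕ → ℕ := fun j => if j + m - 3 ≤ L - 2 then j + m - 3 else j + m - 1 - L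
    have hinj : Set.InjOn φ A := by
      intro i hi j hj hij
      simp only [A, Finset.coe_filter, Finset.mem_Icc, Set.mem_ofPred_eq] at hi hj
      simp only [φ] at hij
      split_ifs at hij <;> omega
    have hdis : Disjoint (A.image φ) B := by
      rw [Finset.disjoint_left]
      intro x hx hxB
      rw [Finset.mem_image] at hx
      obtain ⟨j, hj, rfl⟩ := hx
      obtain ⟨hj1, hj2⟩ := Finset.mem_filter.1 hj
      obtain ⟨hx1, hx2⟩ := Finset.mem_filter.1 hxB
      rw [Finset.mem_Icc] at hj1 hx1
      simp only [φ] at hx1 hx2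
      by_cases hjm : j + m - 3 ≤ L - 2
      · rw [if_pos hjm] at hx1 hx2
        have p := hf.isPathList_ascend (a := j) (b := (j + m - 3 : ℕ)) (n := m - 2) (by omega)
          (by omega) (by omega)
        have q := (p.cons hj2 (by
          rw [mem_ascend]; rintro ⟨i, h1, h2, h3⟩
          have := hf.inj h3 (by omega) (by omega)
          omega)).concat (c := f (L - 1)) hx2.symm (by
          rw [List.mem_cons, mem_ascend]
          rintro (h | ⟨i, h1, h2, h3⟩)
          · have := hf.inj h (by omega) (by omega)
            omega
          · have := hf.inj h3 (by omega) (by omega)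
            omega)
        refine hno ?_
        have := q.hasCycle hclose (by simp; omega)
        convert this using 1
        simp; omega
      · rw [if_neg hjm] at hx1 hx2
        have p := hf.isPathList_descend (a := (j + m - 1 - L : ℕ)) (b := 0) (n := j + m - L)
          (by omega) (by omega) (by omega)
        have q := hf.isPathList_ascend (a := j) (b := L - 1) (n := L - j) (by omega) (by omega)
          (by omega)
        have r := p.append q hj2 (by
          intro x hx hx'
          obtain ⟨i, hi1, hi2, rfl⟩ := mem_descend.1 hx
          obtain ⟨i', hi1', hi2', hi3⟩ := mem_ascend.1 hx'
          have := hf.inj hi3 (by omega) (by omega)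
          omega)
        refine hno ?_
        have := r.hasCycle hx2 (by simp; omega)
        convert this using 1
        simp; omega
    have h1 : A.image φ ∪ B ⊆ Finset.Icc 1 (L - 2) := by
      refine Finset.union_subset (fun x hx => ?_) (Finset.filter_subset _ _)
      rw [Finset.mem_image] at hx
      obtain ⟨j, hj, rfl⟩ := hx
      have := Finset.mem_Icc.1 (Finset.mem_filter.1 hj).1
      simp only [φ]
      rw [Finset.mem_Icc]
      split_ifs <;> omega
    have h2 := Finset.card_le_card h1
    rwa [Finset.card_union_of_disjoint hdis, Finset.card_image_of_injOn hinj, Nat.card_Icc,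
      Nat.add_sub_cancel] at h2
  have h1 := hdeg (f 0)
  have h2 := hdeg (f (L - 1))
  omega

end SimpleGraph

namespace SimpleGraph

universe u

variable {V : Type u} {G : SimpleGraph V}

/-! ### Wheels -/

/-- `G` contains a wheel: a cycle with `m` vertices, all adjacent to a further vertex. -/
def HasWheel (G : SimpleGraph V) (m : ℕ) : Prop :=
  ∃ w f, G.IsCycleFun m f ∧ ∀ i, G.Adj w (f i)

theorem IsCycleFun.map {W : Type*} {H : SimpleGraph W} {L : ℕ} {f : ℤ → W}
    (hf : H.IsCycleFun L f) {φ : W → V} (hφ : Function.Injective φ)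
    (h : ∀ x y, H.Adj x y → G.Adj (φ x) (φ y)) : G.IsCycleFun L (φ ∘ f) :=
  ⟨fun i j => by rw [Function.comp_apply, Function.comp_apply, hφ.eq_iff, hf.1],
    fun i => h _ _ (hf.2 i)⟩

theorem induce_compl_adj {S : Set V} {x y : S} (h : (G.induce S)ᶜ.Adj x y) :
    Gᶜ.Adj (x : V) y := by
  rw [SimpleGraph.compl_adj] at h ⊢
  exact ⟨fun h' => h.1 (Subtype.ext h'), h.2⟩

/-- If every graph on at least `c` vertices has a cycle of length `m` or its complement has one,
then every graph on at least `2 * c + 1` vertices has a cycle of length `m` or its complement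
contains a wheel with rim of length `m`: if no vertex has `c` non-neighbors, then the minimum degree
is larger than half the number of vertices. -/
theorem hasCycle_or_hasWheel_compl {m c : ℕ} (hm : 3 ≤ m) (hmc : m ≤ c)
    (hc : ∀ (W : Type u) [Fintype W], c ≤ Fintype.card W → ∀ H : SimpleGraph W, H.HasMonoCycle m)
    [Fintype V] (hV : 2 * c + 1 ≤ Fintype.card V) : G.HasCycle m ∨ Gᶜ.HasWheel m := by
  classical
  by_cases h : ∃ w, c ≤ Gᶜ.degree w
  · obtain ⟨w, hw⟩ := h
    rw [← card_neighborSet_eq_degree] at hw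
    rcases hc (Gᶜ.neighborSet w) hw (G.induce _) with h | h
    · obtain ⟨-, f, hf⟩ := h
      exact .inl ⟨hm, _, hf.map Subtype.val_injective fun x y h => h⟩
    · obtain ⟨-, f, hf⟩ := h
      exact .inr ⟨w, _, hf.map Subtype.val_injective fun x y h => induce_compl_adj h,
        fun i => (f i).2⟩
  · push Not at h
    refine .inl (hasCycle_of_degree hm (by omega) fun v => ?_)
    have h1 := h v
    have h2 := G.degree_compl v
    omega

/-- Some vertex has `2 * c + 1` neighbors in `G` or in the complement, and
`hasCycle_or_hasWheel_compl` applies to these. -/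
theorem hasWheel_or_hasWheel_compl {m c : ℕ} (hm : 3 ≤ m) (hmc : m ≤ c)
    (hc : ∀ (W : Type u) [Fintype W], c ≤ Fintype.card W → ∀ H : SimpleGraph W, H.HasMonoCycle m)
    [Fintype V] (hV : 4 * c + 2 ≤ Fintype.card V) : G.HasWheel m ∨ Gᶜ.HasWheel m := by
  classical
  obtain ⟨v⟩ : Nonempty V := Fintype.card_pos_iff.1 (by omega)
  have key : ∀ H : SimpleGraph V, 2 * c + 1 ≤ Fintype.card (H.neighborSet v) →
      H.HasWheel m ∨ Hᶜ.HasWheel m := by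
    intro H hH
    rcases hasCycle_or_hasWheel_compl (G := H.induce (H.neighborSet v)) hm hmc hc hH with h | h
    · obtain ⟨-, f, hf⟩ := h
      exact .inl ⟨v, _, hf.map Subtype.val_injective fun x y h => h, fun i => (f i).2⟩
    · obtain ⟨w, f, hf, hw⟩ := h
      exact .inr ⟨w, _, hf.map Subtype.val_injective fun x y h => induce_compl_adj h,
        fun i => induce_compl_adj (hw i)⟩
  by_cases h : 2 * c + 1 ≤ G.degree v
  · rw [← card_neighborSet_eq_degree] at h
    exact key G h
  · have h2 := G.degree_compl v
    have h3 : 2 * c + 1 ≤ Gᶜ.degree v := by omega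
    rw [← card_neighborSet_eq_degree] at h3
    have := key Gᶜ (by convert h3)
    rwa [compl_compl, or_comm] at this

theorem HasWheel.isContained {n : ℕ} (h : G.HasWheel (n - 1)) :
    (wheelGraph n).IsContained G := by
  obtain ⟨w, f, hf, hw⟩ := h
  have hadj : ∀ {i j : Fin (n - 1)}, ((i - j : Fin (n - 1)) : ℕ) = 1 → G.Adj (f j) (f i) := by
    intro i j hij
    have h1 := hf.2 j
    convert h1 using 1
    refine hf.eq_of_dvd ?_
    rw [Fin.val_sub] at hij
    have h2 := Nat.div_add_mod (n - 1 - (j : ℕ) + i) (n - 1)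
    rw [hij] at h2
    refine ⟨((n - 1 - (j : ℕ) + i) / (n - 1) : ℕ) - 1, ?_⟩
    have h3 : (((n - 1) * ((n - 1 - (j : ℕ) + i) / (n - 1)) + 1 : ℕ) : ℤ) =
        ((n - 1 - (j : ℕ) + i : ℕ) : ℤ) := by rw [h2]
    rw [Nat.cast_add, Nat.cast_mul, Nat.cast_add, Nat.cast_sub j.2.le, Nat.cast_one] at h3
    rw [mul_sub, mul_one]
    linarith
  refine ⟨⟨⟨Sum.elim (fun _ => w) fun i : Fin (n - 1) => f i, ?_⟩, ?_⟩⟩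
  · rintro (x | i) (y | j) hxy
    · simp [wheelGraph, joinGraph, Subsingleton.elim x y] at hxy
    · exact hw j
    · exact (hw i).symm
    · have : (cycleGraph (n - 1)).Adj i j := by simpa [wheelGraph, joinGraph] using hxy
      rcases cycleGraph_adj'.1 this with h | h
      · exact (hadj h).symm
      · exact hadj h
  · rintro (x | i) (y | j) hxy
    · rw [Subsingleton.elim x y]
    · exact absurd hxy (hw j).ne
    · exact absurd hxy.symm (hw i).ne
    · have := hf.inj (i := (i : ℕ)) (j := (j : ℕ)) hxy (by omega) (by omega)
      congr 1
      ext
      exact_mod_cast this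

end SimpleGraph

/-! ### Bounds for the Ramsey number -/

open SimpleGraph

theorem labelGraph_blue_eq_compl {V : Type*} (c : TopEdgeLabeling V RamseyColor) :
    c.labelGraph RamseyColor.blue = (c.labelGraph RamseyColor.red)ᶜ := by
  ext x y
  rw [SimpleGraph.compl_adj, TopEdgeLabeling.labelGraph_adj, TopEdgeLabeling.labelGraph_adj]
  constructor
  · rintro ⟨hne, h⟩
    refine ⟨hne, ?_⟩
    rintro ⟨_, h'⟩
    rw [h] at h'
    exact RamseyColor.noConfusion h'
  · rintro ⟨hne, h⟩
    refine ⟨hne, ?_⟩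
    cases hc : c.get x y hne with
    | red => exact absurd ⟨hne, hc⟩ h
    | blue => rfl

theorem ramseyProperty_wheelGraph {n c : ℕ} (hn : 3 ≤ n - 1) (hnc : n - 1 ≤ c)
    (hc : ∀ (W : Type) [Fintype W], c ≤ Fintype.card W →
      ∀ H : SimpleGraph W, H.HasMonoCycle (n - 1)) :
    RamseyProperty (wheelGraph n) (wheelGraph n) (4 * c + 2) := by
  intro col
  rw [labelGraph_blue_eq_compl]
  exact (hasWheel_or_hasWheel_compl hn hnc hc (by simp)).imp (fun h => h.isContained)
    fun h => h.isContained

/-- A coloring of the wheel uses the color of the hub only there. -/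
theorem colorable_cycleGraph_of_wheelGraph {n k : ℕ} (h : (wheelGraph n).Colorable (k + 1)) :
    (cycleGraph (n - 1)).Colorable k := by
  obtain ⟨C⟩ := h
  have hub : ∀ i, C (Sum.inr i) ≠ C (Sum.inl 0) := fun i =>
    (C.valid (by simp [wheelGraph, joinGraph])).symm
  have : (cycleGraph (n - 1)).Coloring {x // x ≠ C (Sum.inl 0)} :=
    Coloring.mk (fun i => ⟨C (Sum.inr i), hub i⟩) fun {i j} hij h =>
      C.valid (show (wheelGraph n).Adj (Sum.inr i) (Sum.inr j) by
        simpa [wheelGraph, joinGraph] using hij) (congrArg Subtype.val h)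
  simpa [Fintype.card_subtype_compl] using this.colorable

/-- If the rim is not `k`-colorable, then `k + 1` disjoint red complete graphs on `n - 1` vertices,
with all other edges blue, contain no monochromatic wheel: the red components are too small, and
the blue graph is `(k + 1)`-colorable. -/
theorem lt_of_ramseyProperty_wheelGraph {n k N : ℕ} (hn : 2 ≤ n)
    (hk : ¬(cycleGraph (n - 1)).Colorable k)
    (h : RamseyProperty (wheelGraph n) (wheelGraph n) N) : (k + 1) * (n - 1) < N := by
  by_contra! hN
  obtain ⟨part, hpart⟩ : ∃ part : Fin N → ℕ, part = fun x : Fin N => (x : ℕ) / (n - 1) := ⟨_, rfl⟩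
  let col : TopEdgeLabeling (Fin N) RamseyColor := EdgeLabeling.mk
    (fun x y _ => if part x = part y then .red else .blue) fun x y _ => by simp only [eq_comm]
  rcases h col with ⟨⟨φ⟩⟩ | ⟨⟨φ⟩⟩
  · have hpt : ∀ x, part (φ x) = part (φ (Sum.inl 0)) := by
      rintro (x | i)
      · rw [Subsingleton.elim x 0]
      · have := φ.toHom.map_adj (show (wheelGraph n).Adj (Sum.inl 0) (Sum.inr i) by
          simp [wheelGraph, joinGraph])
        rw [TopEdgeLabeling.labelGraph_adj] at this
        obtain ⟨_, h⟩ := this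
        by_contra hne
        simp [col, EdgeLabeling.get_mk, Ne.symm hne] at h
    have hinj : Function.Injective fun x =>
        (⟨(φ x : ℕ) % (n - 1), Nat.mod_lt _ (by omega)⟩ : Fin (n - 1)) := by
      intro x y hxy
      have h1 : (φ x : ℕ) / (n - 1) = (φ y : ℕ) / (n - 1) := by
        simpa [hpart] using (hpt x).trans (hpt y).symm
      have h2 : (φ x : ℕ) % (n - 1) = (φ y : ℕ) % (n - 1) := by simpa using hxy
      refine φ.injective (Fin.ext ?_)
      have e1 := Nat.div_add_mod (φ x : ℕ) (n - 1)
      rw [h1, h2] at e1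
      exact e1.symm.trans (Nat.div_add_mod (φ y : ℕ) (n - 1))
    have := Fintype.card_le_of_injective _ hinj
    simp at this
  · refine hk (colorable_cycleGraph_of_wheelGraph ⟨Coloring.mk
      (fun x => (⟨part (φ x), ?_⟩ : Fin (k + 1))) fun {x y} hxy he => ?_⟩)
    · rw [hpart]
      exact Nat.div_lt_of_lt_mul (by rw [mul_comm]; omega)
    · have := φ.toHom.map_adj hxy
      rw [TopEdgeLabeling.labelGraph_adj] at this
      obtain ⟨_, h⟩ := this
      simp only [Fin.mk.injEq] at he
      simp [col, EdgeLabeling.get_mk, he] at h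

theorem theorem1p5 (n : ℕ) (hn : 7 ≤ n) :
    (Even n →
      3 * n - 3 ≤ ramseyNumber (wheelGraph n) (wheelGraph n) ∧
        ramseyNumber (wheelGraph n) (wheelGraph n) ≤ 8 * n - 10) ∧
    (Odd n →
      2 * n - 2 ≤ ramseyNumber (wheelGraph n) (wheelGraph n) ∧
        ramseyNumber (wheelGraph n) (wheelGraph n) ≤ 6 * n - 8) := by
  -- A number with the Ramsey property bounds the Ramsey number, which then has the property itself.
  have bounds : ∀ {k N : ℕ}, ¬(cycleGraph (n - 1)).Colorable k →
      RamseyProperty (wheelGraph n) (wheelGraph n) N →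
      (k + 1) * (n - 1) < ramseyNumber (wheelGraph n) (wheelGraph n) ∧
        ramseyNumber (wheelGraph n) (wheelGraph n) ≤ N := fun hk hN =>
    ⟨lt_of_ramseyProperty_wheelGraph (by omega) hk
      (Nat.sInf_mem (s := {N | RamseyProperty (wheelGraph n) (wheelGraph n) N}) ⟨_, hN⟩),
      Nat.sInf_le hN⟩
  constructor
  · rintro ⟨r, hr⟩
    have hup := ramseyProperty_wheelGraph (n := n) (c := 4 * r - 3) (by omega) (by omega)
      fun W _ hW H => by
        rw [show n - 1 = 2 * r - 1 by omega]
        exact hasMonoCycle_odd (by omega) hW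
    have hk : ¬(cycleGraph (n - 1)).Colorable 2 := fun h => by
      have h1 := h.chromaticNumber_le
      rw [chromaticNumber_cycleGraph_of_odd (n - 1) (by omega) ⟨r - 1, by omega⟩] at h1
      exact absurd h1 (by decide)
    have := bounds hk hup
    omega
  · rintro ⟨k, hk⟩
    have hup := ramseyProperty_wheelGraph (n := n) (c := 3 * k - 1) (by omega) (by omega)
      fun W _ hW H => by
        rw [show n - 1 = 2 * k by omega]
        exact hasMonoCycle_even (by omega) hW
    have hk1 : ¬(cycleGraph (n - 1)).Colorable 1 := fun h => by
      have h1 := h.chromaticNumber_le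
      rw [chromaticNumber_cycleGraph_of_even (n - 1) (by omega) ⟨k, by omega⟩] at h1
      exact absurd h1 (by decide)
    have := bounds hk1 hup
    omega
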